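/- Let $M_0$ be a smooth manifold (finite-dimensional, Hausdorff, second countable, without boundary), let $\Omega^\bullet=\Omega^\bullet(M_0)$ be its algebra of differential forms with the exterior product, and let $d$ be the exterior derivative. For $k\in\mathbb Z$ let $\mathrm{Der}^k(\Omega)$ be the space of graded derivations of degree $k$ of $\Omega^\bullet$, i.e. $\mathbb R$-linear maps $D$ with $D(\Omega^p)\subset\Omega^{p+k}$ (where $\Omega^q=0$ for $q<0$) and $D(a\wedge b)=Da\wedge b+(-1)^{kp}a\wedge Db$ for $a\in\Omega^p$. A Lie algebroid structure on $TM_0$ is a derivation $Q\in\mathrm{Der}^1(\Omega)$ with $Q^2=0$; its deformation complex is $\bigl(\mathrm{Der}^\bullet(\Omega),[Q,\cdot]\bigr)$ with $[Q,D]=QD-(-1)^kDQ$ for $D\in\mathrm{Der}^k(\Omega)$. Then: (1) $d$ is a Lie algebroid structure on $TM_0$ (the standard one), and $[d,\cdot]$ maps $\mathrm{Der}^k(\Omega)$ to $\mathrm{Der}^{k+1}(\Omega)$ and has square zero. (2) The deformation complex $\bigl(\mathcal A^{1,\bullet}[1],[d,\cdot]\bigr)=\bigl(\mathrm{Der}^\bullet(\Omega),[d,\cdot]\bigr)$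 is acyclic: for every $k\in\mathbb Z$, every $D\in\mathrm{Der}^k(\Omega)$ with $[d,D]=0$ is of the form $D=[d,E]$ with $E\in\mathrm{Der}^{k-1}(\Omega)$. (3) The standard Lie algebroid structure $d$ is rigid, infinitesimally and formally: (a) every $D\in\mathrm{Der}^1(\Omega)$ with $dD+Dd=0$ is of the form $D=dX-Xd$ with $X\in\mathrm{Der}^0(\Omega)$; (b) for every formal deformation $Q_t=d+\sum_{n\ge1}t^nQ_n$, with $Q_n\in\mathrm{Der}^1(\Omega)$ and $Q_t^2=0$ as a formal power series in $t$, there is a formal family $\varphi_t=\mathrm{id}+\sum_{n\ge1}t^n\varphi_n$, with $\mathbb R$-linear degree-preserving $\varphi_n:\Omega^\bullet\to\Omega^\bullet$ and $\varphi_t(a\wedge b)=\varphi_t(a)\wedge\varphi_t(b)$, such that $\varphi_tQ_t=d\,\varphi_t$. -/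

import Mathlib

open scoped Manifold DirectSum

noncomputable section

namespace DeRham

section Algebra

variable (A : Type*) [CommRing A] [Algebra ℝ A]

/-- Vector fields, as derivations of the algebra `A` of functions. For `A = C^∞(M)`, with `M` a
(Hausdorff, finite dimensional) smooth manifold, these are the smooth vector fields on `M`; the
Lie bracket of `Derivation` is the commutator. -/
abbrev VField : Type _ := Derivation ℝ A A

/-- Differential `p`-forms: alternating `A`-multilinear functions of `p` vector fields. -/
abbrev Form (p : ℕ) : Type _ := VField A [⋀^Fin p]→ₗ[A] A

variable {A}

/-- The exterior product of forms,
`(a ∧ b)(X) = ∑ sign(σ) a(X_σ(1), …, X_σ(p)) b(X_σ(p+1), …, X_σ(p+q))`, the sum being over the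
`(p,q)`-shuffles `σ`. -/
def wedge {p q : ℕ} (a : Form A p) (b : Form A q) : Form A (p + q) :=
  ((LinearMap.mul' A A).compAlternatingMap (a.domCoprod b)).domDomCongr finSumFinEquiv

theorem wedge_add_left {p q : ℕ} (a a' : Form A p) (b : Form A q) :
    wedge (a + a') b = wedge a b + wedge a' b := by
  have h : (a + a').domCoprod b = a.domCoprod b + a'.domCoprod b := by
    simp only [← AlternatingMap.domCoprod'_apply, TensorProduct.add_tmul, map_add]
  ext v
  simp [wedge, h]

theorem wedge_add_right {p q : ℕ} (a : Form A p) (b b' : Form A q) :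
    wedge a (b + b') = wedge a b + wedge a b' := by
  have h : a.domCoprod (b + b') = a.domCoprod b + a.domCoprod b' := by
    simp only [← AlternatingMap.domCoprod'_apply, TensorProduct.tmul_add, map_add]
  ext v
  simp [wedge, h]

theorem wedge_zero_left {p q : ℕ} (b : Form A q) : wedge (0 : Form A p) b = 0 := by
  simpa using wedge_add_left (0 : Form A p) 0 b

theorem wedge_zero_right {p q : ℕ} (a : Form A p) : wedge a (0 : Form A q) = 0 := by
  simpa using wedge_add_right a (0 : Form A q) 0

/-- The value of the exterior derivative (with no numerical prefactor):
`da(X_0, …, X_p) = ∑_i (-1)^i X_i (a(X_0, …, X̂_i, …, X_p))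
  + ∑_{i<j} (-1)^j a(X_0, …, [X_i, X_j], …, X̂_j, …, X_p)`,
where the bracket stands in the place of `X_i`. Moving it to the first place gives the usual sign
`(-1)^(i+j)`. -/
def extDFun {p : ℕ} (a : Form A p) (X : Fin (p + 1) → VField A) : A :=
  (∑ i : Fin (p + 1), (-1) ^ (i : ℕ) * X i (a (i.removeNth X))) +
    ∑ j : Fin (p + 1), ∑ i with i < j,
      (-1) ^ (j : ℕ) * a (j.removeNth (Function.update X i ⁅X i, X j⁆))

section WellDefined

open Function

variable {p : ℕ} (a : Form A p)

/-- The summand `(-1)^j a(X_0, …, X̂_j, …, X_p)`. -/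
def face (j : Fin (p + 1)) (X : Fin (p + 1) → VField A) : A :=
  (-1) ^ (j : ℕ) * a (j.removeNth X)

theorem face_update_self (j : Fin (p + 1)) (X : Fin (p + 1) → VField A) (Z : VField A) :
    face a j (update X j Z) = face a j X := by
  simp [face]

theorem face_add {i j : Fin (p + 1)} (h : i ≠ j) (X : Fin (p + 1) → VField A) (Y Z : VField A) :
    face a j (update X i (Y + Z)) = face a j (update X i Y) + face a j (update X i Z) := by
  obtain ⟨k, rfl⟩ := Fin.exists_succAbove_eq h
  simp [face, Fin.removeNth_update_succAbove, mul_add]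

theorem face_smul {i j : Fin (p + 1)} (h : i ≠ j) (X : Fin (p + 1) → VField A) (f : A)
    (Z : VField A) : face a j (update X i (f • Z)) = f * face a j (update X i Z) := by
  obtain ⟨k, rfl⟩ := Fin.exists_succAbove_eq h
  simp [face, Fin.removeNth_update_succAbove, mul_left_comm]

theorem face_eq_zero {i k j : Fin (p + 1)} (hik : i ≠ k) (hi : i ≠ j) (hk : k ≠ j)
    {X : Fin (p + 1) → VField A} (h : X i = X k) : face a j X = 0 := by
  obtain ⟨i, rfl⟩ := Fin.exists_succAbove_eq hi
  obtain ⟨k, rfl⟩ := Fin.exists_succAbove_eq hk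
  rw [face, a.map_eq_zero_of_eq (j.removeNth X) (i := i) (j := k) h (by rintro rfl; exact hik rfl),
    mul_zero]

theorem face_add_face {i j : Fin (p + 1)} (hij : i ≠ j) {X : Fin (p + 1) → VField A}
    (h : X i = X j) : face a i X + face a j X = 0 := by
  have := a.neg_one_pow_smul_map_removeNth_add_eq_zero_of_eq h hij
  simpa [face, zsmul_eq_mul] using this

theorem extDFun_eq (X : Fin (p + 1) → VField A) :
    extDFun a X = (∑ i, X i (face a i X)) +
      ∑ j, ∑ i with i < j, face a j (update X i ⁅X i, X j⁆) := by
  have (i : Fin (p + 1)) (f : A) : X i ((-1) ^ (i : ℕ) * f) = (-1) ^ (i : ℕ) * X i f := by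
    rcases neg_one_pow_eq_or A (i : ℕ) with h | h <;> simp [h]
  simp only [extDFun, face, this]

theorem face_swap {i j : Fin (p + 1)} (hij : i ≠ j) (X : Fin (p + 1) → VField A) :
    face a j (update X i ⁅X i, X j⁆) = face a i (update X j ⁅X j, X i⁆) := by
  have h := face_add_face a hij (X := update (update X i ⁅X i, X j⁆) j ⁅X i, X j⁆)
    (by simp [hij])
  rw [face_update_self, update_comm hij, face_update_self] at h
  rw [← lie_skew (X j) (X i), ← neg_one_smul A, face_smul a hij.symm]
  linear_combination h

/-- The double sum over `i < j`, doubled, as a sum over all `i ≠ j`. -/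
theorem two_mul_sum (X : Fin (p + 1) → VField A) :
    2 * ∑ j, ∑ i with i < j, face a j (update X i ⁅X i, X j⁆) =
      ∑ j, ∑ i with i ≠ j, face a j (update X i ⁅X i, X j⁆) := by
  have h1 : ∑ j, ∑ i with i < j, face a j (update X i ⁅X i, X j⁆) =
      ∑ j, ∑ i with j < i, face a j (update X i ⁅X i, X j⁆) := by
    simp only [Finset.sum_filter]
    rw [Finset.sum_comm]
    refine Finset.sum_congr rfl fun i _ => Finset.sum_congr rfl fun j _ => ?_
    split_ifs with h
    · exact face_swap a h.ne X
    · rfl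
  rw [two_mul]
  nth_rw 2 [h1]
  rw [← Finset.sum_add_distrib]
  refine Finset.sum_congr rfl fun j _ => ?_
  simp only [Finset.sum_filter, ← Finset.sum_add_distrib]
  refine Finset.sum_congr rfl fun i _ => ?_
  rcases lt_trichotomy i j with h | h | h
  · simp [h, h.ne, h.not_gt]
  · simp [h]
  · simp [h, h.ne', h.not_gt]

/-- Everything that involves the `m`-th vector field, written as if `m` were the last slot. -/
theorem extDFun_split (m : Fin (p + 1)) (X : Fin (p + 1) → VField A) :
    extDFun a X = X m (face a m X) + ∑ i with i ≠ m, X i (face a i X) +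
      ((∑ j with j ≠ m, face a j (update X m ⁅X m, X j⁆)) +
        ∑ j with j ≠ m, ∑ i with i ≠ m ∧ i < j, face a j (update X i ⁅X i, X j⁆)) := by
  rw [extDFun_eq]
  congr 1
  · rw [← Finset.sum_filter_add_sum_filter_not Finset.univ (· = m)]
    simp [Finset.filter_eq']
  · rw [← Finset.sum_filter_add_sum_filter_not Finset.univ (· = m)]
    have h1 : (∑ i with i < m, face a m (update X i ⁅X i, X m⁆)) =
        ∑ j with j ≠ m ∧ j < m, face a j (update X m ⁅X m, X j⁆) := by
      refine Finset.sum_congr ?_ fun i hi => ?_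
      · ext i; simpa using fun h : i < m => h.ne
      · exact face_swap a (by simpa using (Finset.mem_filter.1 hi).2.1) X
    have h2 : ∀ j ∈ Finset.univ.filter (fun j => ¬ j = m),
        (∑ i with i < j, face a j (update X i ⁅X i, X j⁆)) =
          (if m < j then face a j (update X m ⁅X m, X j⁆) else 0) +
            ∑ i with i ≠ m ∧ i < j, face a j (update X i ⁅X i, X j⁆) := by
      intro j _
      rw [← Finset.sum_filter_add_sum_filter_not (Finset.univ.filter (· < j)) (· = m)]
      congr 1
      · rw [Finset.filter_filter]
        split_ifs with h
        · rw [show Finset.univ.filter (fun i => i < j ∧ i = m) = {m} by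
            ext i; simp only [Finset.mem_filter, Finset.mem_univ, true_and, Finset.mem_singleton]
            exact ⟨fun h => h.2, fun h' => ⟨h' ▸ h, h'⟩⟩]
          simp
        · exact Finset.sum_eq_zero fun i hi => by
            have h3 := (Finset.mem_filter.1 hi).2
            exact absurd (h3.2 ▸ h3.1) h
      · rw [Finset.filter_filter]
        simp only [and_comm, ne_eq]
    rw [Finset.sum_congr rfl h2, Finset.sum_add_distrib, ← add_assoc]
    congr 1
    simp only [Finset.filter_eq', Finset.mem_univ, if_true, Finset.sum_singleton]
    rw [h1, ← Finset.sum_filter, Finset.filter_filter,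
      ← Finset.sum_filter_add_sum_filter_not (Finset.univ.filter (· ≠ m)) (· < m),
      Finset.filter_filter, Finset.filter_filter]
    congr 1
    refine Finset.sum_congr ?_ fun _ _ => rfl
    ext j
    simp only [Finset.mem_filter, Finset.mem_univ, true_and, ne_eq, and_congr_right_iff]
    intro h
    omega

theorem extDFun_update_add (X : Fin (p + 1) → VField A) (m : Fin (p + 1)) (Y Z : VField A) :
    extDFun a (update X m (Y + Z)) = extDFun a (update X m Y) + extDFun a (update X m Z) := by
  simp only [extDFun_split a m, face_update_self, update_self, update_idem]
  have e1 (W : VField A) : (∑ i with i ≠ m, update X m W i (face a i (update X m W))) =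
      ∑ i with i ≠ m, X i (face a i (update X m W)) :=
    Finset.sum_congr rfl fun i hi => by
      rw [update_of_ne (Finset.mem_filter.1 hi).2]
  have e2 (W : VField A) : (∑ j with j ≠ m, face a j (update X m ⁅W, update X m W j⁆)) =
      ∑ j with j ≠ m, face a j (update X m ⁅W, X j⁆) :=
    Finset.sum_congr rfl fun i hi => by
      rw [update_of_ne (Finset.mem_filter.1 hi).2]
  have e3 (W : VField A) : (∑ j with j ≠ m, ∑ i with i ≠ m ∧ i < j,
        face a j (update (update X m W) i ⁅update X m W i, update X m W j⁆)) =
      ∑ j with j ≠ m, ∑ i with i ≠ m ∧ i < j, face a j (update (update X i ⁅X i, X j⁆) m W) :=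
    Finset.sum_congr rfl fun j hj => Finset.sum_congr rfl fun i hi => by
      rw [update_of_ne (Finset.mem_filter.1 hj).2, update_of_ne (Finset.mem_filter.1 hi).2.1,
        update_comm (Finset.mem_filter.1 hi).2.1.symm]
  have e4 : (∑ i with i ≠ m, X i (face a i (update X m (Y + Z)))) =
      (∑ i with i ≠ m, X i (face a i (update X m Y))) +
        ∑ i with i ≠ m, X i (face a i (update X m Z)) := by
    rw [← Finset.sum_add_distrib]
    exact Finset.sum_congr rfl fun i hi => by
      rw [face_add a (Finset.mem_filter.1 hi).2.symm, map_add]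
  have e5 : (∑ j with j ≠ m, face a j (update X m ⁅Y + Z, X j⁆)) =
      (∑ j with j ≠ m, face a j (update X m ⁅Y, X j⁆)) +
        ∑ j with j ≠ m, face a j (update X m ⁅Z, X j⁆) := by
    rw [← Finset.sum_add_distrib]
    exact Finset.sum_congr rfl fun i hi => by
      rw [add_lie, face_add a (Finset.mem_filter.1 hi).2.symm]
  have e6 : (∑ j with j ≠ m, ∑ i with i ≠ m ∧ i < j,
        face a j (update (update X i ⁅X i, X j⁆) m (Y + Z))) =
      (∑ j with j ≠ m, ∑ i with i ≠ m ∧ i < j, face a j (update (update X i ⁅X i, X j⁆) m Y)) +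
      ∑ j with j ≠ m, ∑ i with i ≠ m ∧ i < j, face a j (update (update X i ⁅X i, X j⁆) m Z) := by
    rw [← Finset.sum_add_distrib]
    refine Finset.sum_congr rfl fun j hj => ?_
    rw [← Finset.sum_add_distrib]
    exact Finset.sum_congr rfl fun i hi => by
      rw [face_add a (Finset.mem_filter.1 hj).2.symm]
  rw [e1, e1, e1, e2, e2, e2, e3, e3, e3, e4, e5, e6, Derivation.add_apply]
  ring

theorem extDFun_update_smul (X : Fin (p + 1) → VField A) (m : Fin (p + 1)) (f : A)
    (Y : VField A) :
    extDFun a (update X m (f • Y)) = f • extDFun a (update X m Y) := by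
  simp only [extDFun_split a m, face_update_self, update_self, update_idem]
  have e1 (W : VField A) : (∑ i with i ≠ m, update X m W i (face a i (update X m W))) =
      ∑ i with i ≠ m, X i (face a i (update X m W)) :=
    Finset.sum_congr rfl fun i hi => by
      rw [update_of_ne (Finset.mem_filter.1 hi).2]
  have e2 (W : VField A) : (∑ j with j ≠ m, face a j (update X m ⁅W, update X m W j⁆)) =
      ∑ j with j ≠ m, face a j (update X m ⁅W, X j⁆) :=
    Finset.sum_congr rfl fun i hi => by
      rw [update_of_ne (Finset.mem_filter.1 hi).2]
  have e3 (W : VField A) : (∑ j with j ≠ m, ∑ i with i ≠ m ∧ i < j,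
        face a j (update (update X m W) i ⁅update X m W i, update X m W j⁆)) =
      ∑ j with j ≠ m, ∑ i with i ≠ m ∧ i < j, face a j (update (update X i ⁅X i, X j⁆) m W) :=
    Finset.sum_congr rfl fun j hj => Finset.sum_congr rfl fun i hi => by
      rw [update_of_ne (Finset.mem_filter.1 hj).2, update_of_ne (Finset.mem_filter.1 hi).2.1,
        update_comm (Finset.mem_filter.1 hi).2.1.symm]
  have e4 : (∑ i with i ≠ m, X i (face a i (update X m (f • Y)))) =
      f * (∑ i with i ≠ m, X i (face a i (update X m Y))) +
        ∑ i with i ≠ m, X i f * face a i (update X m Y) := by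
    rw [Finset.mul_sum, ← Finset.sum_add_distrib]
    exact Finset.sum_congr rfl fun i hi => by
      rw [face_smul a (Finset.mem_filter.1 hi).2.symm, Derivation.leibniz, smul_eq_mul,
        smul_eq_mul, mul_comm (X i f)]
  have e5 : (∑ j with j ≠ m, face a j (update X m ⁅f • Y, X j⁆)) =
      f * (∑ j with j ≠ m, face a j (update X m ⁅Y, X j⁆)) -
        ∑ j with j ≠ m, X j f * face a j (update X m Y) := by
    rw [Finset.mul_sum, ← Finset.sum_sub_distrib]
    refine Finset.sum_congr rfl fun i hi => ?_
    have hb : ⁅f • Y, X i⁆ = f • ⁅Y, X i⁆ + (-(X i f)) • Y := by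
      ext g
      simp only [Derivation.commutator_apply, Derivation.add_apply, Derivation.smul_apply,
        Derivation.leibniz, smul_eq_mul]
      ring
    rw [hb, face_add a (Finset.mem_filter.1 hi).2.symm, face_smul a (Finset.mem_filter.1 hi).2.symm,
      face_smul a (Finset.mem_filter.1 hi).2.symm]
    ring
  have e6 : (∑ j with j ≠ m, ∑ i with i ≠ m ∧ i < j,
        face a j (update (update X i ⁅X i, X j⁆) m (f • Y))) =
      f * ∑ j with j ≠ m, ∑ i with i ≠ m ∧ i < j,
        face a j (update (update X i ⁅X i, X j⁆) m Y) := by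
    rw [Finset.mul_sum]
    refine Finset.sum_congr rfl fun j hj => ?_
    rw [Finset.mul_sum]
    exact Finset.sum_congr rfl fun i hi => by
      rw [face_smul a (Finset.mem_filter.1 hj).2.symm]
  rw [e1, e1, e2, e2, e3, e3, e4, e5, e6, Derivation.smul_apply, smul_eq_mul, smul_eq_mul]
  ring

theorem extDFun_eq_zero (X : Fin (p + 1) → VField A) {b c : Fin (p + 1)} (h : X b = X c)
    (hbc : b ≠ c) : extDFun a X = 0 := by
  have h1 : (∑ i, X i (face a i X)) = 0 := by
    rw [Fintype.sum_eq_add b c hbc fun i hi => by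
      rw [face_eq_zero a hbc hi.1.symm hi.2.symm h, map_zero], h, ← map_add,
      face_add_face a hbc h, map_zero]
  have hpair (j : Fin (p + 1)) (hb : b ≠ j) (hc : c ≠ j) :
      face a j (update X b ⁅X b, X j⁆) + face a j (update X c ⁅X c, X j⁆) = 0 := by
    have hG (P Q : VField A) : face a j (update (update X b (P + Q)) c (P + Q)) =
        face a j (update (update X b P) c P) + face a j (update (update X b P) c Q) +
          (face a j (update (update X b Q) c P) + face a j (update (update X b Q) c Q)) := by
      rw [face_add a hc, update_comm hbc, update_comm hbc, face_add a hb, face_add a hb]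
      simp only [update_comm hbc.symm]
      ring
    have h0 (P : VField A) : face a j (update (update X b P) c P) = 0 :=
      face_eq_zero a hbc hb hc (by simp [hbc])
    have h5 := hG (X b) ⁅X b, X j⁆
    rw [h0, h0, h0, update_eq_self, update_comm hbc, h, update_eq_self, ← h] at h5
    rw [← h]
    linear_combination -h5
  have h2 : 2 * (∑ j, ∑ i with i < j, face a j (update X i ⁅X i, X j⁆)) = 0 := by
    rw [two_mul_sum]
    set T : Fin (p + 1) → Fin (p + 1) → A :=
      fun i j => if i ≠ j then face a j (update X i ⁅X i, X j⁆) else 0 with hT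
    have hsymm (i j) : T i j = T j i := by
      by_cases hij : i = j
      · rw [hij]
      · simp only [hT, ne_eq, hij, Ne.symm hij, not_false_eq_true, if_true, face_swap a hij]
    have hzero {i j : Fin (p + 1)} (hij : i ≠ j) (h' : X i = X j) : T i j = 0 := by
      obtain ⟨k, rfl⟩ := Fin.exists_succAbove_eq hij
      simp only [hT, h', lie_self, face, Fin.removeNth_update_succAbove]
      simp
    have hsum (i) : T b i + T c i = 0 := by
      by_cases hb : b = i
      · subst hb; simp [hzero hbc.symm h.symm]; simp [hT]
      by_cases hc : c = i
      · subst hc; simp [hzero hbc h]; simp [hT]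
      simpa [hT, hb, hc] using hpair i hb hc
    have hC (j) (hj : j ≠ b ∧ j ≠ c) : ∑ i, T i j = 0 := by
      rw [Fintype.sum_eq_add b c hbc, hsum]
      intro i hi
      by_cases hij : i = j
      · simp [hT, hij]
      · simp only [hT, ne_eq, hij, not_false_eq_true, if_true]
        exact face_eq_zero a hbc hj.1.symm hj.2.symm
          (by rw [update_of_ne hi.1.symm, update_of_ne hi.2.symm, h])
    simp only [Finset.sum_filter]
    change ∑ j, ∑ i, T i j = 0
    rw [Fintype.sum_eq_add b c hbc hC, ← Finset.sum_add_distrib]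
    exact Finset.sum_eq_zero fun i _ => by rw [hsymm i b, hsymm i c, hsum]
  have h3 : (∑ j, ∑ i with i < j, face a j (update X i ⁅X i, X j⁆)) = 0 := by
    have h4 := congrArg (fun x : A => (1 / 2 : ℝ) • x) h2
    simpa [two_mul, ← two_smul ℝ, smul_smul] using h4
  rw [extDFun_eq, h1, h3, add_zero]

end WellDefined

/-- The exterior derivative on `p`-forms. -/
def extD (p : ℕ) : Form A p →ₗ[ℝ] Form A (p + 1) where
  toFun a :=
    { toFun := extDFun a
      map_update_add' := fun {inst} X m Y Z => by
        rw [Subsingleton.elim inst (instDecidableEqFin _)]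
        exact extDFun_update_add a X m Y Z
      map_update_smul' := fun {inst} X m f Y => by
        rw [Subsingleton.elim inst (instDecidableEqFin _)]
        exact extDFun_update_smul a X m f Y
      map_eq_zero_of_eq' := fun X _ _ h hbc => extDFun_eq_zero a X h hbc }
  map_add' a b := by
    ext X
    change extDFun (a + b) X = extDFun a X + extDFun b X
    simp only [extDFun, AlternatingMap.add_apply, map_add, mul_add, Finset.sum_add_distrib]
    ring
  map_smul' r a := by
    ext X
    change extDFun (r • a) X = r • extDFun a X
    simp only [extDFun, AlternatingMap.smul_apply, Derivation.map_smul, mul_smul_comm, smul_add,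
      Finset.smul_sum]

instance : DirectSum.GNonUnitalNonAssocSemiring (fun p : ℕ => Form A p) where
  mul a b := wedge a b
  mul_zero a := wedge_zero_right a
  zero_mul b := wedge_zero_left b
  mul_add a b c := wedge_add_right a b c
  add_mul a b c := wedge_add_left a b c

variable (A)

/-- The algebra `Ω^• = ⨁_p Ω^p` of differential forms. -/
def Forms : Type _ := ⨁ p : ℕ, Form A p

/-- The product of the algebra of differential forms is the exterior product. -/
instance : NonUnitalNonAssocRing (Forms A) :=
  inferInstanceAs (NonUnitalNonAssocRing (⨁ p : ℕ, Form A p))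

instance : Module ℝ (Forms A) := inferInstanceAs (Module ℝ (⨁ p : ℕ, Form A p))

variable {A}

/-- A `p`-form, as an element of the algebra of all forms. -/
def ofForm (p : ℕ) : Form A p →ₗ[ℝ] Forms A :=
  DirectSum.lof ℝ ℕ (fun p : ℕ => Form A p) p

/-- The component of degree `p` of an element of the algebra of all forms. -/
def component (p : ℕ) : Forms A →ₗ[ℝ] Form A p :=
  DirectSum.component ℝ ℕ (fun p : ℕ => Form A p) p

theorem ofForm_mul_ofForm {p q : ℕ} (a : Form A p) (b : Form A q) :
    ofForm p a * ofForm q b = ofForm (p + q) (wedge a b) :=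
  DirectSum.of_mul_of (A := fun p : ℕ => Form A p) a b

theorem Forms.induction {P : Forms A → Prop} (h0 : P 0) (hof : ∀ p (a : Form A p), P (ofForm p a))
    (hadd : ∀ x y, P x → P y → P (x + y)) (x : Forms A) : P x :=
  DirectSum.induction_on (β := fun p : ℕ => Form A p) x h0 hof hadd

theorem smul_eq_algebraMap_smul {p : ℕ} (r : ℝ) (a : Form A p) : r • a = algebraMap ℝ A r • a := by
  ext v
  simp [Algebra.smul_def]

theorem wedge_smul_right {p q : ℕ} (r : ℝ) (a : Form A p) (b : Form A q) :
    wedge a (r • b) = r • wedge a b := by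
  have h : a.domCoprod (algebraMap ℝ A r • b) = algebraMap ℝ A r • a.domCoprod b := by
    simp only [← AlternatingMap.domCoprod'_apply, TensorProduct.tmul_smul, map_smul]
  rw [smul_eq_algebraMap_smul r b, smul_eq_algebraMap_smul r (wedge a b)]
  ext v
  simp [wedge, h]

instance : SMulCommClass ℝ (Forms A) (Forms A) where
  smul_comm r x y := by
    simp only [smul_eq_mul]
    induction x using Forms.induction with
    | h0 => simp
    | hadd x x' h h' => rw [add_mul, add_mul, smul_add, h, h']
    | hof p a =>
      induction y using Forms.induction with
      | h0 => simp
      | hadd x x' h h' => rw [mul_add, smul_add, smul_add, mul_add, h, h']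
      | hof q b =>
        rw [ofForm_mul_ofForm, ← map_smul, ← map_smul, ofForm_mul_ofForm, wedge_smul_right]

theorem wedge_smul_left {p q : ℕ} (r : ℝ) (a : Form A p) (b : Form A q) :
    wedge (r • a) b = r • wedge a b := by
  have h : (algebraMap ℝ A r • a).domCoprod b = algebraMap ℝ A r • a.domCoprod b := by
    rw [← AlternatingMap.domCoprod'_apply, ← TensorProduct.smul_tmul', map_smul,
      AlternatingMap.domCoprod'_apply]
  rw [smul_eq_algebraMap_smul r a, smul_eq_algebraMap_smul r (wedge a b)]
  ext v
  simp [wedge, h]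

instance : IsScalarTower ℝ (Forms A) (Forms A) where
  smul_assoc r x y := by
    simp only [smul_eq_mul]
    induction x using Forms.induction with
    | h0 => simp
    | hadd x x' h h' => rw [add_mul, smul_add, add_mul, smul_add, h, h']
    | hof p a =>
      induction y using Forms.induction with
      | h0 => simp
      | hadd x x' h h' => rw [mul_add, mul_add, smul_add, h, h']
      | hof q b =>
        rw [ofForm_mul_ofForm, ← map_smul, ← map_smul, ofForm_mul_ofForm, wedge_smul_left]

variable (A)

/-- The de Rham differential on the algebra of all forms. -/
def deRhamD : Module.End ℝ (Forms A) :=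
  DirectSum.toModule ℝ ℕ (Forms A) fun p => ofForm (p + 1) ∘ₗ extD p

theorem deRhamD_ofForm {p : ℕ} (a : Form A p) :
    deRhamD A (ofForm p a) = ofForm (p + 1) (extD p a) :=
  DirectSum.toModule_lof (M := fun p : ℕ => Form A p) ℝ p a

/-- `D` is homogeneous of degree `k`: it maps `Ω^p` to `Ω^(p+k)`, which is `0` if `p + k < 0`. -/
def IsHomogeneous (k : ℤ) (D : Module.End ℝ (Forms A)) : Prop :=
  ∀ (p : ℕ) (a : Form A p) (q : ℕ), (q : ℤ) ≠ p + k → component q (D (ofForm p a)) = 0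

/-- The graded derivations of degree `k` of the algebra of differential forms:
`D(a ∧ b) = D a ∧ b + (-1)^(k p) a ∧ D b` for `a` of degree `p`. -/
def Der (k : ℤ) : Submodule ℝ (Module.End ℝ (Forms A)) where
  carrier := {D | IsHomogeneous A k D ∧ ∀ (p : ℕ) (a : Form A p) (b : Forms A),
    D (ofForm p a * b) = D (ofForm p a) * b + (k * p).negOnePow • (ofForm p a * D b)}
  zero_mem' := ⟨fun _ _ _ _ => by simp, fun _ _ _ => by simp⟩
  add_mem' := fun {D D'} h h' =>
    ⟨fun p a q hq => by
      rw [LinearMap.add_apply, map_add, h.1 p a q hq, h'.1 p a q hq, add_zero],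
    fun p a b => by
      simp only [LinearMap.add_apply, h.2, h'.2, add_mul, mul_add, smul_add]
      abel⟩
  smul_mem' := fun r D h =>
    ⟨fun p a q hq => by rw [LinearMap.smul_apply, map_smul, h.1 p a q hq, smul_zero],
    fun p a b => by
      simp only [LinearMap.smul_apply, h.2, smul_add, smul_mul_assoc, mul_smul_comm]
      rcases Int.units_eq_one_or (k * p).negOnePow with e | e <;> simp [e]⟩

variable {A}

/-- The graded commutator `[Q, D] = Q D - (-1)^k D Q` of an operator `Q` of degree `1` and an
operator `D` of degree `k`. -/
def gradedComm (Q : Module.End ℝ (Forms A)) (k : ℤ) (D : Module.End ℝ (Forms A)) :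
    Module.End ℝ (Forms A) :=
  Q * D - k.negOnePow • (D * Q)

variable (A)

/-- A Lie algebroid structure on the tangent bundle, as a homological vector field on the tangent
bundle with fibres shifted by `1`: a derivation of degree `1` and square zero of the algebra of
differential forms. The standard structure (identity anchor, commutator of vector fields)
is the de Rham differential. -/
structure IsLieAlgebroid (Q : Module.End ℝ (Forms A)) : Prop where
  mem_der : Q ∈ Der A 1
  sq_zero : Q * Q = 0

/-- The deformation complex of the Lie algebroid structure `Q`, whose term in degree `k` is the space
of derivations of degree `k` and whose differential is `[Q, ·]`, is a cochain complex. -/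
def IsDeformationComplex (Q : Module.End ℝ (Forms A)) : Prop :=
  ∀ (k : ℤ), ∀ D ∈ Der A k,
    gradedComm Q k D ∈ Der A (k + 1) ∧ gradedComm Q (k + 1) (gradedComm Q k D) = 0

/-- The deformation complex of `Q` is acyclic: every cocycle, of any degree, is a coboundary. -/
def IsAcyclicDeformationComplex (Q : Module.End ℝ (Forms A)) : Prop :=
  ∀ (k : ℤ), ∀ D ∈ Der A k, gradedComm Q k D = 0 →
    ∃ E ∈ Der A (k - 1), gradedComm Q (k - 1) E = D

/-- `Q_t = ∑_n t^n Q_n` is a formal deformation of `Q`: a Lie algebroid structure with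
coefficients in formal power series in `t` that is equal to `Q` at `t = 0`. -/
structure IsFormalDeformation (Q : Module.End ℝ (Forms A)) (q : ℕ → Module.End ℝ (Forms A)) :
    Prop where
  zero : q 0 = Q
  mem_der : ∀ n, q n ∈ Der A 1
  sq_zero : ∀ n, ∑ i ∈ Finset.HasAntidiagonal.antidiagonal n, q i.1 * q i.2 = 0

/-- `φ_t = ∑_n t^n φ_n` is a formal family of automorphisms of the graded algebra of forms that
is the identity at `t = 0`. -/
structure IsFormalAutomorphism (φ : ℕ → Module.End ℝ (Forms A)) : Prop where
  zero : φ 0 = 1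
  homogeneous : ∀ n, IsHomogeneous A 0 (φ n)
  map_mul : ∀ n a b, φ n (a * b) = ∑ i ∈ Finset.HasAntidiagonal.antidiagonal n, φ i.1 a * φ i.2 b

/-- `Q` is rigid: every infinitesimal deformation `Q + t D` (modulo `t^2`) and every formal
deformation of `Q` is trivial, that is, conjugate to `Q` by an infinitesimal automorphism `1 + t X`,
respectively by a formal family of automorphisms starting at the identity. -/
structure IsRigid (Q : Module.End ℝ (Forms A)) : Prop where
  infinitesimal : ∀ D ∈ Der A 1, Q * D + D * Q = 0 → ∃ X ∈ Der A 0, D = Q * X - X * Q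
  formal : ∀ q, IsFormalDeformation A Q q → ∃ φ, IsFormalAutomorphism A φ ∧
    ∀ n, ∑ i ∈ Finset.HasAntidiagonal.antidiagonal n, φ i.1 * q i.2 = Q * φ n

end Algebra

/-- The algebra of smooth real functions on a smooth manifold of dimension `n`. -/
abbrev SmoothFun (n : ℕ) (M : Type*) [TopologicalSpace M]
    [ChartedSpace (EuclideanSpace ℝ (Fin n)) M] : Type _ :=
  ContMDiffMap (𝓡 n) 𝓘(ℝ, ℝ) M ℝ ((⊤ : ℕ∞) : WithTop ℕ∞)

end DeRham
end

/-! A graded derivation of the algebra of forms is determined by its values on functions `f` and on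
their differentials `df`, since every form is locally a combination of products of these
(`der_eq_zero`). For `D` of degree `k ≥ 0`, the map `f ↦ D f` is a derivation of the functions with
values in `k`-forms, hence a vector valued `k`-form `K`, locally `∑ D(x_i) ⊗ ∂_i`. Its insertion
`i_K` is a derivation of degree `k - 1` that kills functions and sends `df` to `D f`
(`insertion_mem_der`, `insertion_d_fn`). If `[d, D] = 0`, then `[d, (-1)^k i_K]` agrees with `D` on
functions by construction and on differentials because `d D f = (-1)^k D df`, so the two are equal.
If `k < 0`, then `D` kills functions for degree reasons, hence also differentials, and `D = 0`.

Infinitesimal rigidity is the degree one case of acyclicity. For a formal deformation, `φ_t` is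
sought as the flow of a time dependent family `Y` of derivations of degree `0`, which makes it
multiplicative (`formalFlow_map_mul`). The lowest nonzero coefficient of `φ_t Q_t - d φ_t` is a
derivation of degree `1` that anticommutes with `d` (`defect_mem_der`, `defect_anticomm`), so it is
`[d, X]`, and one new coefficient of `Y`, a multiple of `X`, removes it (`defect_update`).

The rules of calculus on forms are proved by contraction: a form is zero when all functions obtained
from it by iterated contraction are zero. If the failures of an identity have zero function part,
and each contraction of a failure is a combination of failures of the same identity, then all
failures vanish (`eq_zero_of_interior_mem_span`). Direct computation is needed only for the
contraction of an exterior product, a sum over permutations, and for the value of the Lie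
derivative, read off from Koszul's formula. Associativity, graded commutativity, the Leibniz rules,
`[L_X, L_Y] = L_[X,Y]` and `d² = 0` then follow formally.

Geometry enters only through `LocalFrame`, an expansion `X g = ∑ X(x_i) ∂_i g` valid for every
derivation `X` of the smooth functions. It comes from Hadamard's lemma in charts, bump functions and
a partition of unity (`exists_localFrame`). -/

noncomputable section

namespace DeRham

/-! ### Contraction of forms with vector fields. -/

section Interior

variable {A : Type*} [CommRing A] [Algebra ℝ A]

/-- The coefficient function of the degree zero part of a form. -/
def augment : Forms A →ₗ[ℝ] A where
  toFun x := component 0 x ![]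
  map_add' x y := by simp
  map_smul' r x := by simp

/-- The interior product with a vector field. -/
def interior (X : VField A) : Module.End ℝ (Forms A) :=
  DirectSum.toModule ℝ ℕ (Forms A) fun p =>
    match p with
    | 0 => 0
    | p + 1 => ofForm p ∘ₗ
      { toFun := fun a => a.curryLeft X
        map_add' := fun _ _ => rfl
        map_smul' := fun _ _ => rfl }

@[simp]
theorem interior_ofForm_zero (X : VField A) (a : Form A 0) : interior X (ofForm 0 a) = 0 :=
  DirectSum.toModule_lof (M := fun p : ℕ => Form A p) ℝ 0 a

@[simp]
theorem interior_ofForm_succ (X : VField A) {p : ℕ} (a : Form A (p + 1)) :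
    interior X (ofForm (p + 1) a) = ofForm p (a.curryLeft X) :=
  DirectSum.toModule_lof (M := fun p : ℕ => Form A p) ℝ (p + 1) a

theorem component_ofForm_self {p : ℕ} (a : Form A p) : component p (ofForm p a) = a :=
  DirectSum.component.lof_self (M := fun p : ℕ => Form A p) ℝ p a

theorem component_ofForm_of_ne {p q : ℕ} (h : p ≠ q) (a : Form A p) :
    component q (ofForm p a) = 0 := by
  have := DirectSum.component.of (M := fun p : ℕ => Form A p) (R := ℝ) q p a
  rw [dif_neg h] at this
  exact this

theorem forms_ext {x y : Forms A} (h : ∀ p, component p x = component p y) : x = y :=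
  DirectSum.ext_component (M := fun p : ℕ => Form A p) ℝ h

theorem end_ext {S T : Module.End ℝ (Forms A)}
    (h : ∀ p (a : Form A p), S (ofForm p a) = T (ofForm p a)) : S = T :=
  LinearMap.ext fun x => by
    induction x using Forms.induction with
    | h0 => simp
    | hof p a => exact h p a
    | hadd x y hx hy => rw [map_add, map_add, hx, hy]

theorem component_interior (X : VField A) (p : ℕ) (x : Forms A) :
    component p (interior X x) = (component (p + 1) x).curryLeft X := by
  induction x using Forms.induction with
  | h0 => simp
  | hadd x y hx hy => simp [hx, hy]
  | hof q a =>
    cases q with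
    | zero => simp [component_ofForm_of_ne]
    | succ q =>
      rw [interior_ofForm_succ]
      by_cases h : q = p
      · subst h; simp [component_ofForm_self]
      · rw [component_ofForm_of_ne h, component_ofForm_of_ne (by omega)]; simp

theorem form_zero_apply (a : Form A 0) (v : Fin 0 → VField A) : a v = a ![] :=
  congrArg a (Subsingleton.elim _ _)

/-- A form vanishes if all the functions obtained by contracting it with vector fields vanish. -/
theorem eq_zero_of_contractions {x : Forms A}
    (h : ∀ l : List (VField A), augment (l.foldl (fun y X => interior X y) x) = 0) : x = 0 := by
  refine forms_ext fun p => ?_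
  induction p generalizing x with
  | zero =>
    ext v
    rw [form_zero_apply]
    simpa [augment] using h []
  | succ p ih =>
    ext v
    have h1 := ih (x := interior (v 0) x) fun l => h (v 0 :: l)
    have h2 := congrArg (fun b : Form A p => b (Fin.tail v)) h1
    simp only [component_interior, map_zero, AlternatingMap.zero_apply,
      AlternatingMap.curryLeft_apply_apply] at h2
    rw [map_zero, AlternatingMap.zero_apply, ← h2]
    exact congrArg _ (Fin.cons_self_tail v).symm

/-- Shuffles represent the cosets of `S_p × S_q` in `S_(p+q)`, and the summand is constant on each
coset, so a sum over all permutations counts every shuffle `p! q!` times. Sums over the full group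
are easier to reindex, and the factor can be cancelled over `ℝ`. -/
theorem wedge_apply_factorial {p q : ℕ} (a : Form A p) (b : Form A q)
    (v : Fin (p + q) → VField A) :
    (p.factorial * q.factorial : ℕ) • wedge a b v = ∑ σ : Equiv.Perm (Fin (p + q)),
      Equiv.Perm.sign σ • (a (fun k => v (σ (Fin.castAdd q k))) *
        b (fun k => v (σ (Fin.natAdd p k)))) := by
  have h := MultilinearMap.domCoprod_alternization_eq a b
  have h1 := congrArg (fun c => LinearMap.mul' A A (c (v ∘ finSumFinEquiv))) h
  simp only [Fintype.card_fin, AlternatingMap.smul_apply, map_nsmul] at h1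
  have h2 : wedge a b v = LinearMap.mul' A A (a.domCoprod b (v ∘ finSumFinEquiv)) := rfl
  rw [h2, ← h1, MultilinearMap.alternatization_apply, map_sum]
  refine Fintype.sum_equiv finSumFinEquiv.permCongr _ _ fun σ => ?_
  rw [Equiv.Perm.sign_permCongr]
  rcases Int.units_eq_one_or (Equiv.Perm.sign σ) with e | e <;>
    simp [e, Equiv.permCongr_apply]

end Interior

/-! ### Permutations sorted by the preimage of the first letter. -/

section Shuffles

open Equiv

/-- A permutation of `n + 1` letters, from the preimage of `0` and a permutation of `n` letters. -/
def permInsert {n : ℕ} (x : Fin (n + 1) × Perm (Fin n)) : Perm (Fin (n + 1)) :=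
  Perm.decomposeFin.symm (0, x.2) * x.1.cycleRange

theorem permInsert_self {n : ℕ} (i : Fin (n + 1)) (τ : Perm (Fin n)) : permInsert (i, τ) i = 0 := by
  simp [permInsert]

theorem permInsert_succAbove {n : ℕ} (i : Fin (n + 1)) (τ : Perm (Fin n)) (k : Fin n) :
    permInsert (i, τ) (i.succAbove k) = (τ k).succ := by
  simp [permInsert, Fin.cycleRange_succAbove]

theorem sign_permInsert {n : ℕ} (i : Fin (n + 1)) (τ : Perm (Fin n)) :
    Perm.sign (permInsert (i, τ)) = (-1) ^ (i : ℕ) * Perm.sign τ := by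
  simp [permInsert, mul_comm]

theorem permInsert_bijective (n : ℕ) : Function.Bijective (permInsert (n := n)) := by
  refine (Fintype.bijective_iff_injective_and_card _).2 ⟨?_, ?_⟩
  · rintro ⟨i, τ⟩ ⟨j, ρ⟩ h
    have hij : i = j := by
      have h1 := permInsert_self i τ
      rw [h, ← permInsert_self j ρ] at h1
      exact (permInsert (j, ρ)).injective h1
    subst hij
    have : τ = ρ := by
      ext k
      have h1 := permInsert_succAbove i τ k
      rw [h, permInsert_succAbove] at h1
      exact congrArg Fin.val (Fin.succ_injective _ h1.symm)
    rw [this]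
  · simp [Fintype.card_perm, Nat.factorial_succ]

theorem vecCons_comp_permInsert {V : Type*} {n : ℕ} (X : V) (v : Fin n → V) (i : Fin (n + 1))
    (τ : Perm (Fin n)) :
    (fun k => (Matrix.vecCons X v : Fin (n + 1) → V) (permInsert (i, τ) k)) =
      i.insertNth X (fun k => v (τ k)) := by
  funext k
  refine Fin.succAboveCases i ?_ (fun j => ?_) k
  · simp [permInsert_self]
  · simp [permInsert_succAbove]

theorem insertNth_mk_of_lt {V : Type*} {n : ℕ} (i : Fin (n + 1)) (X : V) (w : Fin n → V) {k : ℕ}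
    (h : k < i) : (i.insertNth X w : Fin (n + 1) → V) ⟨k, h.trans i.isLt⟩ = w ⟨k, by omega⟩ := by
  have : (⟨k, h.trans i.isLt⟩ : Fin (n + 1)) = i.succAbove ⟨k, by omega⟩ := by
    rw [Fin.succAbove_of_castSucc_lt _ _ (by simpa [Fin.lt_def] using h)]
    rfl
  rw [this, Fin.insertNth_apply_succAbove]

theorem insertNth_mk_of_gt {V : Type*} {n : ℕ} (i : Fin (n + 1)) (X : V) (w : Fin n → V) {k : ℕ}
    (h : i < k + 1) (hk : k < n) :
    (i.insertNth X w : Fin (n + 1) → V) ⟨k + 1, by omega⟩ = w ⟨k, hk⟩ := by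
  have : (⟨k + 1, by omega⟩ : Fin (n + 1)) = i.succAbove ⟨k, hk⟩ := by
    rw [Fin.succAbove_of_le_castSucc _ _ (by rw [Fin.le_def]; simpa using Nat.lt_succ_iff.1 h)]
    rfl
  rw [this, Fin.insertNth_apply_succAbove]

/-- A family indexed by `Fin (n + 1)` with an element inserted, restricted to a window of
consecutive indices which contains the place of the insertion. -/
theorem insertNth_window {V : Type*} {n p c : ℕ} (i : Fin (n + 1)) (X : V) (w : Fin n → V)
    (j : Fin (p + 1)) (hj : (i : ℕ) = c + j) (hc : c + p ≤ n) :
    (fun k : Fin (p + 1) => (i.insertNth X w : Fin (n + 1) → V) ⟨c + k, by omega⟩) =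
      j.insertNth X (fun k : Fin p => w ⟨c + k, by omega⟩) := by
  funext ⟨k, hk⟩
  rcases lt_trichotomy k j with h | h | h
  · rw [insertNth_mk_of_lt j X _ h, insertNth_mk_of_lt i X w (by simp only; omega)]
  · have h1 : (⟨k, hk⟩ : Fin (p + 1)) = j := Fin.ext h
    have h2 : (⟨c + k, by omega⟩ : Fin (n + 1)) = i := Fin.ext (by simp only; omega)
    simp only [h1, h2, Fin.insertNth_apply_same]
  · obtain ⟨k, rfl⟩ : ∃ l, k = l + 1 := ⟨k - 1, by omega⟩
    rw [insertNth_mk_of_gt j X _ h (by omega)]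
    exact insertNth_mk_of_gt i X w (k := c + k) (by omega) (by omega)

end Shuffles

/-! ### The permutation sum of an exterior product, with one vector singled out. -/

section InteriorMul

open Equiv

variable {A : Type*} [CommRing A] [Algebra ℝ A]

/-- The sum over all permutations that is `p! q!` times the exterior product of a `p`-form and a
`q`-form. -/
def permSum {n p q : ℕ} (h : p + q = n) (a : Form A p) (b : Form A q) (v : Fin n → VField A) : A :=
  -- The offset `0 +` gives the arguments of `a` the shape of the windows in `insertNth_window`,
  -- with `c = 0`.
  ∑ σ : Perm (Fin n), Perm.sign σ • (a (fun k => v (σ ⟨0 + k, by omega⟩)) *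
    b (fun k => v (σ ⟨p + k, by omega⟩)))

theorem component_mul_apply {n p q : ℕ} (h : p + q = n) (a : Form A p) (b : Form A q)
    (v : Fin n → VField A) :
    (p.factorial * q.factorial : ℕ) • component n (ofForm p a * ofForm q b) v =
      permSum h a b v := by
  subst h
  rw [ofForm_mul_ofForm, component_ofForm_self, wedge_apply_factorial]
  simp only [permSum, zero_add]
  rfl

/-- The index `i` is the place at which the permutation puts `X`, and `τ` arranges the remaining
vectors. Bringing `X` to place `i` costs `(-1)^i`. -/
theorem permSum_vecCons {n p q : ℕ} (h : p + q = n + 1) (a : Form A p) (b : Form A q)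
    (X : VField A) (v : Fin n → VField A) :
    permSum h a b (Matrix.vecCons X v) = ∑ i : Fin (n + 1), (-1) ^ (i : ℕ) *
      ∑ τ : Perm (Fin n), Perm.sign τ •
        (a (fun k => (i.insertNth X (fun k => v (τ k)) : Fin (n + 1) → VField A)
            ⟨0 + k, by omega⟩) *
          b (fun k => (i.insertNth X (fun k => v (τ k)) : Fin (n + 1) → VField A)
            ⟨p + k, by omega⟩)) := by
  rw [permSum, ← (permInsert_bijective n).sum_comp, Fintype.sum_prod_type]
  refine Finset.sum_congr rfl fun i _ => ?_
  rw [Finset.mul_sum]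
  refine Finset.sum_congr rfl fun τ _ => ?_
  rw [sign_permInsert, ← vecCons_comp_permInsert]
  rcases Int.units_eq_one_or (Perm.sign τ) with e | e <;>
    rcases Nat.even_or_odd (i : ℕ) with e' | e' <;> simp [e, e'.neg_one_pow, Units.smul_def]

/-- When `X` is an argument of `a`, moving it to the front of `a` costs a second `(-1)^i`. The signs
cancel, and all such places contribute equally. -/
theorem permSum_slot_left {n p q : ℕ} (h : p + 1 + q = n + 1) (h' : p + q = n)
    (a : Form A (p + 1)) (b : Form A q)
    (X : VField A) (v : Fin n → VField A) (i : Fin (n + 1)) (hi : (i : ℕ) < p + 1) :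
    (-1) ^ (i : ℕ) * ∑ τ : Perm (Fin n), Perm.sign τ •
        (a (fun k => (i.insertNth X (fun k => v (τ k)) : Fin (n + 1) → VField A)
            ⟨0 + k, by omega⟩) *
          b (fun k => (i.insertNth X (fun k => v (τ k)) : Fin (n + 1) → VField A)
            ⟨p + 1 + k, by omega⟩)) = permSum h' (a.curryLeft X) b v := by
  rw [permSum, Finset.mul_sum]
  refine Finset.sum_congr rfl fun τ _ => ?_
  rw [insertNth_window i X _ ⟨i, hi⟩ (by simp) (by omega), AlternatingMap.map_insertNth]
  have h2 : (fun k : Fin q => (i.insertNth X (fun k => v (τ k)) : Fin (n + 1) → VField A)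
      ⟨p + 1 + k, by omega⟩) = fun k : Fin q => v (τ ⟨p + k, by omega⟩) := by
    funext k
    rw [← insertNth_mk_of_gt i X (fun k => v (τ k)) (k := p + k) (by omega) (by omega)]
    congr 2
    omega
  rw [h2]
  rcases Int.units_eq_one_or (Perm.sign τ) with e | e <;>
    rcases Nat.even_or_odd (i : ℕ) with e' | e' <;> simp [e, e'.neg_one_pow, Units.smul_def]

/-- When `X` is an argument of `b`, it stands at place `i - p` there, and the two signs `(-1)^i` and
`(-1)^(i-p)` leave `(-1)^p`. -/
theorem permSum_slot_right {n p q : ℕ} (h : p + (q + 1) = n + 1) (h' : p + q = n)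
    (a : Form A p) (b : Form A (q + 1))
    (X : VField A) (v : Fin n → VField A) (i : Fin (n + 1)) (hi : p ≤ (i : ℕ)) :
    (-1) ^ (i : ℕ) * ∑ τ : Perm (Fin n), Perm.sign τ •
        (a (fun k => (i.insertNth X (fun k => v (τ k)) : Fin (n + 1) → VField A)
            ⟨0 + k, by omega⟩) *
          b (fun k => (i.insertNth X (fun k => v (τ k)) : Fin (n + 1) → VField A)
            ⟨p + k, by omega⟩)) = (-1) ^ p * permSum h' a (b.curryLeft X) v := by
  rw [permSum, Finset.mul_sum, Finset.mul_sum]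
  refine Finset.sum_congr rfl fun τ _ => ?_
  rw [insertNth_window i X _ ⟨i - p, by omega⟩ (by simp only; omega) (by omega),
    AlternatingMap.map_insertNth]
  have h2 : (fun k : Fin p => (i.insertNth X (fun k => v (τ k)) : Fin (n + 1) → VField A)
      ⟨0 + k, by omega⟩) = fun k : Fin p => v (τ ⟨0 + k, by omega⟩) := by
    funext k
    exact insertNth_mk_of_lt i X (fun k => v (τ k)) (k := 0 + k) (by omega)
  rw [h2]
  obtain ⟨j, hj⟩ := Nat.exists_eq_add_of_le hi
  simp only [hj, Nat.add_sub_cancel_left, pow_add]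
  rcases Int.units_eq_one_or (Perm.sign τ) with e | e <;>
    rcases Nat.even_or_odd j with e' | e' <;> simp [e, e'.neg_one_pow, Units.smul_def]

end InteriorMul

/-! ### Contraction as an antiderivation, and the principle of proof by contraction. -/

section InteriorMul

variable {A : Type*} [CommRing A] [Algebra ℝ A]

theorem nsmul_cancel {V : Type*} [AddCommGroup V] [Module ℝ V] {n : ℕ} (hn : n ≠ 0) {a b : V}
    (h : n • a = n • b) : a = b := by
  rw [← Nat.cast_smul_eq_nsmul ℝ, ← Nat.cast_smul_eq_nsmul ℝ] at h
  have h1 := congrArg (fun c => (n : ℝ)⁻¹ • c) h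
  simpa [smul_smul, hn] using h1

/-- The grading involution, `(-1)^p` on `p`-forms. -/
def bar : Module.End ℝ (Forms A) :=
  DirectSum.toModule ℝ ℕ (Forms A) fun p => (-1 : ℝ) ^ p • ofForm p

theorem bar_ofForm {p : ℕ} (a : Form A p) : bar (ofForm p a) = (-1 : ℝ) ^ p • ofForm p a :=
  DirectSum.toModule_lof (M := fun p : ℕ => Form A p) ℝ p a

theorem card_fin_lt (n p : ℕ) (h : p ≤ n) :
    (Finset.univ.filter fun i : Fin n => (i : ℕ) < p).card = p := by
  rw [Fin.card_filter_val_lt, min_eq_right h]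

theorem card_fin_not_lt (n p q : ℕ) (h : p + q = n) :
    (Finset.univ.filter fun i : Fin n => ¬ (i : ℕ) < p).card = q := by
  have h1 := Finset.card_filter_add_card_filter_not (s := (Finset.univ : Finset (Fin n)))
    (fun i : Fin n => (i : ℕ) < p)
  rw [card_fin_lt n p (by omega), Finset.card_univ, Fintype.card_fin] at h1
  omega

/-- The places of `X` split into `p` equal contributions through `a` and `q` equal contributions
through `b`. These counts are exactly the factors by which `p! q!` exceeds the normalisations
`(p-1)! q!` and `p! (q-1)!` of the two products on the right. -/
theorem component_interior_mul {n p q : ℕ} (h : p + q = n + 1) (a : Form A p) (b : Form A q)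
    (X : VField A) (v : Fin n → VField A) :
    component (n + 1) (ofForm p a * ofForm q b) (Matrix.vecCons X v) =
      component n (interior X (ofForm p a) * ofForm q b) v +
        (-1) ^ p * component n (ofForm p a * interior X (ofForm q b)) v := by
  refine nsmul_cancel (n := p.factorial * q.factorial) (by positivity) ?_
  rw [component_mul_apply h, permSum_vecCons,
    ← Finset.sum_filter_add_sum_filter_not _ (fun i : Fin (n + 1) => (i : ℕ) < p), smul_add]
  congr 1
  · cases p with
    | zero => simp
    | succ p =>
      have h' : p + q = n := by omega
      rw [Finset.sum_congr rfl fun i hi =>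
        permSum_slot_left h h' a b X v i (Finset.mem_filter.1 hi).2, Finset.sum_const,
        card_fin_lt _ _ (by omega), interior_ofForm_succ, ← component_mul_apply h', smul_smul,
        Nat.factorial_succ, mul_assoc]
  · cases q with
    | zero =>
      rw [Finset.card_eq_zero.1 (card_fin_not_lt (n + 1) p 0 h)]
      simp
    | succ q =>
      have h' : p + q = n := by omega
      rw [Finset.sum_congr rfl fun i hi =>
        permSum_slot_right h h' a b X v i (not_lt.1 (Finset.mem_filter.1 hi).2), Finset.sum_const,
        card_fin_not_lt _ _ _ h, interior_ofForm_succ, ← component_mul_apply h', mul_smul_comm,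
        smul_smul, Nat.factorial_succ]
      congr 1
      ring

theorem interior_ofForm_mul_ofForm (X : VField A) {p q : ℕ} (a : Form A p) (b : Form A q) :
    interior X (ofForm p a * ofForm q b) = interior X (ofForm p a) * ofForm q b +
      bar (ofForm p a) * interior X (ofForm q b) := by
  refine forms_ext fun n => ?_
  rw [component_interior]
  by_cases h : p + q = n + 1
  · ext v
    rw [AlternatingMap.curryLeft_apply_apply, component_interior_mul h, bar_ofForm, map_add,
      AlternatingMap.add_apply, smul_mul_assoc, map_smul, AlternatingMap.smul_apply,
      Algebra.smul_def]
    simp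
  · rw [ofForm_mul_ofForm, component_ofForm_of_ne h, bar_ofForm, smul_mul_assoc, map_add, map_smul,
      AlternatingMap.curryLeft_zero, LinearMap.zero_apply]
    have h1 : component n (interior X (ofForm p a) * ofForm q b) = 0 := by
      cases p with
      | zero => simp
      | succ p =>
        rw [interior_ofForm_succ, ofForm_mul_ofForm, component_ofForm_of_ne (by omega)]
    have h2 : component n (ofForm p a * interior X (ofForm q b)) = 0 := by
      cases q with
      | zero => simp
      | succ q =>
        rw [interior_ofForm_succ, ofForm_mul_ofForm, component_ofForm_of_ne (by omega)]
    rw [h1, h2, smul_zero, add_zero]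

/-- Bilinear identities can be checked on homogeneous forms. -/
theorem forms_induction₂ {P : Forms A → Forms A → Prop} (h0l : ∀ y, P 0 y) (h0r : ∀ x, P x 0)
    (hof : ∀ p q (a : Form A p) (b : Form A q), P (ofForm p a) (ofForm q b))
    (haddl : ∀ x x' y, P x y → P x' y → P (x + x') y)
    (haddr : ∀ x y y', P x y → P x y' → P x (y + y')) (x y : Forms A) : P x y := by
  induction x using Forms.induction with
  | h0 => exact h0l y
  | hadd x x' h h' => exact haddl x x' y h h'
  | hof p a =>
    induction y using Forms.induction with
    | h0 => exact h0r _
    | hadd x x' h h' => exact haddr _ x x' h h'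
    | hof q b => exact hof p q a b

/-- The interior product is an antiderivation. -/
theorem interior_mul (X : VField A) (x y : Forms A) :
    interior X (x * y) = interior X x * y + bar x * interior X y := by
  induction x, y using forms_induction₂ with
  | h0l y => simp
  | h0r y => simp
  | hof p q a b => exact interior_ofForm_mul_ofForm X a b
  | haddl x x' y h h' => simp only [add_mul, map_add, h, h']; abel
  | haddr x x' y h h' => simp only [mul_add, map_add, h, h']; abel

theorem bar_bar (x : Forms A) : bar (bar x) = x := by
  induction x using Forms.induction with
  | h0 => simp
  | hadd x y hx hy => simp [hx, hy]
  | hof p a => simp [bar_ofForm, smul_smul, ← mul_pow]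

theorem bar_mul (x y : Forms A) : bar (x * y) = bar x * bar y := by
  induction x, y using forms_induction₂ with
  | h0l y => simp
  | h0r y => simp
  | hof p q a b =>
    rw [ofForm_mul_ofForm, bar_ofForm, bar_ofForm, bar_ofForm, smul_mul_assoc, mul_smul_comm,
      smul_smul, ofForm_mul_ofForm, pow_add]
  | haddl x x' y h h' => simp only [add_mul, map_add, h, h']
  | haddr x x' y h h' => simp only [mul_add, map_add, h, h']

theorem interior_bar (X : VField A) (x : Forms A) : interior X (bar x) = -bar (interior X x) := by
  induction x using Forms.induction with
  | h0 => simp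
  | hadd x y hx hy => simp only [map_add, hx, hy]; abel
  | hof p a =>
    cases p with
    | zero => simp [bar_ofForm]
    | succ p => simp [bar_ofForm, pow_succ]

theorem augment_ofForm_succ {p : ℕ} (a : Form A (p + 1)) : augment (ofForm (p + 1) a) = 0 := by
  simp [augment, component_ofForm_of_ne]

theorem augment_ofForm_zero (a : Form A 0) : augment (ofForm 0 a) = a ![] := by
  simp [augment, component_ofForm_self]

theorem augment_mul (x y : Forms A) : augment (x * y) = augment x * augment y := by
  induction x, y using forms_induction₂ with
  | h0l y => simp
  | h0r y => simp
  | hof p q a b =>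
    rcases p with _ | p
    · rcases q with _ | q
      · have h := component_mul_apply (n := 0) rfl a b ![]
        simp only [Nat.factorial_zero, mul_one, one_smul, permSum] at h
        rw [augment_ofForm_zero, augment_ofForm_zero]
        refine h.trans ?_
        simp [form_zero_apply a, form_zero_apply b]
      · rw [ofForm_mul_ofForm, augment_ofForm_succ, mul_zero]
        exact augment_ofForm_succ _
    · rw [ofForm_mul_ofForm, augment_ofForm_succ, zero_mul]
      simp [augment, component_ofForm_of_ne (show p + 1 + q ≠ 0 by omega)]
  | haddl x x' y h h' => simp only [add_mul, map_add, h, h']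
  | haddr x x' y h h' => simp only [mul_add, map_add, h, h']

theorem augment_bar (x : Forms A) : augment (bar x) = augment x := by
  induction x using Forms.induction with
  | h0 => simp
  | hadd x y hx hy => simp [hx, hy]
  | hof p a =>
    cases p with
    | zero => simp [bar_ofForm]
    | succ p => simp [bar_ofForm, augment_ofForm_succ]

/-- To prove that two families of forms are equal, it is enough to compare their functions and to
know that the interior products of the differences are linear combinations of differences. -/
theorem eq_zero_of_interior_mem_span {ι : Type*} (F : ι → Forms A) (h0 : ∀ i, augment (F i) = 0)
    (h : ∀ X i, interior X (F i) ∈ Submodule.span ℝ (Set.range F)) (i : ι) : F i = 0 := by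
  have key : ∀ (l : List (VField A)), ∀ x ∈ Submodule.span ℝ (Set.range F),
      augment (l.foldl (fun y X => interior X y) x) = 0 := by
    intro l
    induction l with
    | nil =>
      intro x hx
      induction hx using Submodule.span_induction with
      | mem x hx => obtain ⟨i, rfl⟩ := hx; exact h0 i
      | zero => simp
      | add x y _ _ hx hy => simp only [List.foldl_nil] at *; simp [hx, hy]
      | smul r x _ hx => simp only [List.foldl_nil] at *; simp [hx]
    | cons X l ih =>
      intro x hx
      refine ih _ ?_
      induction hx using Submodule.span_induction with
      | mem x hx => obtain ⟨i, rfl⟩ := hx; exact h X i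
      | zero => simp
      | add x y _ _ hx hy => simpa only [map_add] using add_mem hx hy
      | smul r x _ hx => simpa only [map_smul] using Submodule.smul_mem _ _ hx
  exact eq_zero_of_contractions fun l => key l _ (Submodule.subset_span ⟨i, rfl⟩)

end InteriorMul

/-! ### Associativity and graded commutativity of the exterior product. -/

section AlgebraLaws

variable {A : Type*} [CommRing A] [Algebra ℝ A]

theorem mem_span_range {ι : Type*} {F : ι → Forms A} (i : ι) :
    F i ∈ Submodule.span ℝ (Set.range F) :=
  Submodule.subset_span ⟨i, rfl⟩

/-- Contracting an associator gives the sum of three associators, one for each factor that is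
contracted, and functions are associative. -/
theorem forms_mul_assoc (x y z : Forms A) : x * y * z = x * (y * z) := by
  have h := eq_zero_of_interior_mem_span
    (fun t : Forms A × Forms A × Forms A => t.1 * t.2.1 * t.2.2 - t.1 * (t.2.1 * t.2.2))
    (fun t => by simp only [map_sub, augment_mul]; ring)
    (fun X ⟨x, y, z⟩ => by
      have : interior X (x * y * z - x * (y * z)) =
          (interior X x * y * z - interior X x * (y * z)) +
          (bar x * interior X y * z - bar x * (interior X y * z)) +
          (bar x * bar y * interior X z - bar x * (bar y * interior X z)) := by
        simp only [map_sub, interior_mul, bar_mul, add_mul, mul_add]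
        abel
      simp only [this]
      exact add_mem (add_mem (mem_span_range (interior X x, y, z))
        (mem_span_range (bar x, interior X y, z))) (mem_span_range (bar x, bar y, interior X z)))
    (x, y, z)
  exact sub_eq_zero.1 h

theorem bar_pow_interior (X : VField A) (p : ℕ) (y : Forms A) :
    interior X ((bar ^ p) y) = (-1 : ℝ) ^ p • (bar ^ p) (interior X y) := by
  induction p with
  | zero => simp
  | succ p ih =>
    rw [pow_succ', Module.End.mul_apply, Module.End.mul_apply, interior_bar, ih, map_smul, pow_succ,
      mul_smul, neg_one_smul, smul_neg]

theorem augment_bar_pow (p : ℕ) (x : Forms A) : augment ((bar ^ p) x) = augment x := by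
  induction p with
  | zero => simp
  | succ p ih => rw [pow_succ', Module.End.mul_apply, augment_bar, ih]

/-- Graded commutativity. -/
theorem ofForm_mul_comm {p : ℕ} (a : Form A p) (y : Forms A) :
    ofForm p a * y = (bar ^ p) y * ofForm p a := by
  induction p generalizing y with
  | zero =>
    have h := eq_zero_of_interior_mem_span (fun y : Forms A => ofForm 0 a * y - y * ofForm 0 a)
      (fun t => by simp only [map_sub, augment_mul]; ring)
      (fun X y => by
        have : interior X (ofForm 0 a * y - y * ofForm 0 a) =
            ofForm 0 a * interior X y - interior X y * ofForm 0 a := by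
          simp [interior_mul, bar_ofForm]
        simp only [this]
        exact mem_span_range (interior X y)) y
    simpa using sub_eq_zero.1 h
  | succ p ih =>
    -- The family runs over all pairs `(a, y)`. Contracting `y` stays within the family, while the
    -- terms where `a` is contracted cancel by the induction hypothesis in degree `p`, since `bar`
    -- is an involution.
    have h := eq_zero_of_interior_mem_span
      (fun t : Form A (p + 1) × Forms A =>
        ofForm (p + 1) t.1 * t.2 - (bar ^ (p + 1)) t.2 * ofForm (p + 1) t.1)
      (fun t => by simp only [map_sub, augment_mul, augment_bar_pow]; ring)
      (fun X ⟨a, y⟩ => by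
        have : interior X (ofForm (p + 1) a * y - (bar ^ (p + 1)) y * ofForm (p + 1) a) =
            (-1 : ℝ) ^ (p + 1) • (ofForm (p + 1) a * interior X y -
              (bar ^ (p + 1)) (interior X y) * ofForm (p + 1) a) := by
          have hb : bar ((bar ^ (p + 1)) y) = (bar ^ p) y := by
            rw [pow_succ', Module.End.mul_apply, bar_bar]
          rw [map_sub, interior_mul, interior_mul, bar_pow_interior, bar_ofForm,
            interior_ofForm_succ, hb, ih]
          simp only [smul_sub, smul_mul_assoc]
          abel
        simp only [this]
        exact Submodule.smul_mem _ _ (mem_span_range (a, interior X y)))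
      (a, y)
    exact sub_eq_zero.1 h

variable (A) in
/-- A function, as a form of degree `0`. -/
def fn : A →ₗ[ℝ] Forms A where
  toFun f := ofForm 0 (AlternatingMap.constOfIsEmpty A (VField A) (Fin 0) f)
  map_add' f g := by rw [← map_add]; rfl
  map_smul' r f := by rw [← map_smul]; rfl

theorem augment_fn (f : A) : augment (fn A f) = f := by
  rw [fn]; simp [augment_ofForm_zero]

theorem interior_fn (X : VField A) (f : A) : interior X (fn A f) = 0 := interior_ofForm_zero _ _

theorem bar_fn (f : A) : bar (fn A f) = fn A f := by simp [fn, bar_ofForm]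

theorem ofForm_zero_eq (a : Form A 0) : ofForm 0 a = fn A (a ![]) := by
  rw [fn]
  change _ = ofForm 0 _
  congr 1
  ext v
  simp [form_zero_apply]

theorem forms_eq_of_interior {x y : Forms A} (h0 : augment x = augment y)
    (h : ∀ X, interior X x = interior X y) : x = y := by
  refine sub_eq_zero.1 (eq_zero_of_contractions fun l => ?_)
  cases l with
  | nil => simp [h0]
  | cons X l =>
    have : ∀ l : List (VField A), augment (l.foldl (fun y X => interior X y) 0) = 0 := by
      intro l
      induction l with
      | nil => simp
      | cons X l ih => simpa using ih
    simpa [h X] using this l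

theorem fn_mul_ofForm (f : A) {p : ℕ} (a : Form A p) : fn A f * ofForm p a = ofForm p (f • a) := by
  induction p with
  | zero =>
    refine forms_eq_of_interior ?_ fun X => ?_
    · simp [augment_mul, augment_fn, augment_ofForm_zero]
    · simp [interior_mul, interior_fn]
  | succ p ih =>
    refine forms_eq_of_interior ?_ fun X => ?_
    · simp [augment_mul, augment_ofForm_succ]
    · simp [interior_mul, interior_fn, bar_fn, ih]

theorem fn_mul (f g : A) : fn A (f * g) = fn A f * fn A g := by
  refine forms_eq_of_interior ?_ fun X => ?_
  · simp [augment_mul, augment_fn]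
  · simp [interior_mul, interior_fn]

theorem fn_comm (f : A) (x : Forms A) : fn A f * x = x * fn A f := by
  rw [fn]
  exact (ofForm_mul_comm _ x).trans (by simp)

end AlgebraLaws

/-! ### Cartan calculus: the Lie derivative, the Leibniz rule for `d`, and `d² = 0`. -/

section Cartan

variable {A : Type*} [CommRing A] [Algebra ℝ A]

local notation "𝒹" => deRhamD A

/-- The Lie derivative, by Cartan's formula. -/
def lieDeriv (X : VField A) : Module.End ℝ (Forms A) := interior X * 𝒹 + 𝒹 * interior X

theorem lieDeriv_apply (X : VField A) (x : Forms A) :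
    lieDeriv X x = interior X (𝒹 x) + 𝒹 (interior X x) := rfl

theorem augment_d (x : Forms A) : augment (𝒹 x) = 0 := by
  induction x using Forms.induction with
  | h0 => simp
  | hadd x y hx hy => simp [hx, hy]
  | hof p a => rw [deRhamD_ofForm, augment_ofForm_succ]

theorem bar_d (x : Forms A) : bar (𝒹 x) = -𝒹 (bar x) := by
  induction x using Forms.induction with
  | h0 => simp
  | hadd x y hx hy => simp only [map_add, hx, hy]; abel
  | hof p a => simp [deRhamD_ofForm, bar_ofForm, pow_succ]

theorem bar_lieDeriv (X : VField A) (x : Forms A) : bar (lieDeriv X x) = lieDeriv X (bar x) := by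
  have h (y : Forms A) : bar (interior X y) = -interior X (bar y) := by rw [interior_bar, neg_neg]
  simp only [lieDeriv_apply, map_add, h, bar_d, map_neg, neg_neg]

theorem extD_apply {p : ℕ} (a : Form A p) (v : Fin (p + 1) → VField A) :
    extD p a v = extDFun a v := rfl

theorem interior_d_fn (X : VField A) (f : A) : interior X (𝒹 (fn A f)) = fn A (X f) := by
  rw [fn]
  change interior X (𝒹 (ofForm 0 _)) = ofForm 0 _
  rw [deRhamD_ofForm, interior_ofForm_succ]
  congr 1
  ext v
  rw [AlternatingMap.curryLeft_apply_apply, extD_apply, extDFun]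
  simp

/-- The value of the Lie derivative of a form. -/
theorem extDFun_vecCons {p : ℕ} (a : Form A (p + 1)) (X : VField A) (v : Fin (p + 1) → VField A) :
    extDFun a (Matrix.vecCons X v) = X (a v) - ∑ j, a (Function.update v j ⁅X, v j⁆) -
      extDFun (a.curryLeft X) v := by
  have hsq (j : ℕ) : ((-1 : A) ^ j) * (-1) ^ j = 1 := by
    rw [← mul_pow]; simp
  have h1 (i : Fin (p + 1)) (Z : VField A) (u : Fin (p + 1) → VField A) :
      i.succ.removeNth (Matrix.vecCons Z u) = Matrix.vecCons Z (i.removeNth u) := by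
    funext k
    refine Fin.cases ?_ (fun k => ?_) k
    · simp [Fin.removeNth]
    · simp [Fin.removeNth]
  have h2 (i : Fin (p + 1)) (Z : VField A) :
      Function.update (Matrix.vecCons X v : Fin (p + 2) → VField A) i.succ Z =
        Matrix.vecCons X (Function.update v i Z) :=
    (Fin.cons_update (α := fun _ => VField A) X v i Z).symm
  have h3 (Z : VField A) : Function.update (Matrix.vecCons X v : Fin (p + 2) → VField A) 0 Z =
      Matrix.vecCons Z v :=
    Fin.update_cons_zero (α := fun _ => VField A) X v Z
  have h4 (j : Fin (p + 1)) (Z : VField A) :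
      a (Matrix.vecCons Z (j.removeNth v)) = (-1) ^ (j : ℕ) * a (Function.update v j Z) := by
    have := a.map_insertNth j Z (j.removeNth v)
    rw [Fin.insertNth_removeNth] at this
    rw [this, zsmul_eq_mul]
    push_cast
    rw [← mul_assoc, hsq, one_mul]
  have h0 : (0 : Fin (p + 2)).removeNth (Matrix.vecCons X v) = v := by
    funext k; simp [Fin.removeNth]
  -- The index `i = 0` contributes the bracket with `X`, whose sign is absorbed by moving it back to
  -- slot `j`. The other indices give the bracket terms of the derivative of the contracted form,
  -- with opposite sign.
  have h5 (j : Fin (p + 1)) : (∑ i with i < j.succ, (-1) ^ ((j : ℕ) + 1) * a (j.succ.removeNth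
        (Function.update (Matrix.vecCons X v) i
          ⁅(Matrix.vecCons X v : Fin (p + 2) → VField A) i, v j⁆))) =
      - a (Function.update v j ⁅X, v j⁆) - ∑ i with i < j, (-1) ^ (j : ℕ) *
        a.curryLeft X (j.removeNth (Function.update v i ⁅v i, v j⁆)) := by
    rw [Finset.sum_filter, Fin.sum_univ_succ]
    simp only [Matrix.cons_val_zero, h3, h1, h4, Matrix.cons_val_succ, h2, pow_succ,
      AlternatingMap.curryLeft_apply_apply, Fin.succ_pos, if_true, Fin.succ_lt_succ_iff,
      ← Finset.sum_filter]
    rw [sub_eq_add_neg, ← Finset.sum_neg_distrib]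
    congr 1
    · linear_combination (- a (Function.update v j ⁅X, v j⁆)) * hsq j
    · refine Finset.sum_congr rfl fun i _ => ?_
      ring
  have h6 : (Finset.univ.filter fun i : Fin (p + 2) => i < 0) = ∅ := by simp
  rw [extDFun, Fin.sum_univ_succ, h0, Fin.sum_univ_succ (n := p + 1) (f := fun j => ∑ i with i < j, _),
    h6]
  simp only [Matrix.cons_val_zero, Matrix.cons_val_succ, Fin.val_zero, Fin.val_succ, h1]
  rw [Finset.sum_congr rfl fun j _ => h5 j, Finset.sum_sub_distrib, extDFun]
  simp only [pow_succ, AlternatingMap.curryLeft_apply_apply, mul_neg, mul_one, neg_mul,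
    Finset.sum_neg_distrib, Finset.sum_empty, pow_zero, one_mul]
  ring

/-- In Cartan's formula the terms of `d ι_X a` cancel against all terms of `ι_X d a` except the
derivative along `X` and the brackets with `X`. In degree `0` there is nothing to contract, hence
the separate case. -/
theorem lieDeriv_ofForm_apply (X : VField A) {p : ℕ} (a : Form A p) :
    ∃ b : Form A p, lieDeriv X (ofForm p a) = ofForm p b ∧
      ∀ v, b v = X (a v) - ∑ j, a (Function.update v j ⁅X, v j⁆) := by
  cases p with
  | zero =>
    refine ⟨AlternatingMap.constOfIsEmpty A (VField A) (Fin 0) (X (a ![])), ?_, fun v => ?_⟩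
    · rw [lieDeriv_apply, interior_ofForm_zero, map_zero, add_zero, ofForm_zero_eq, interior_d_fn]
      rfl
    · simp [form_zero_apply a v]
  | succ p =>
    refine ⟨(extD _ a).curryLeft X + extD _ (a.curryLeft X), ?_, fun v => ?_⟩
    · rw [lieDeriv_apply, interior_ofForm_succ, deRhamD_ofForm, deRhamD_ofForm,
        interior_ofForm_succ, map_add]
    · rw [AlternatingMap.add_apply, AlternatingMap.curryLeft_apply_apply, extD_apply, extD_apply,
        extDFun_vecCons]
      ring

theorem augment_lieDeriv (X : VField A) (x : Forms A) : augment (lieDeriv X x) = X (augment x) := by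
  induction x using Forms.induction with
  | h0 => simp
  | hadd x y hx hy => simp [hx, hy]
  | hof p a =>
    obtain ⟨b, hb, h⟩ := lieDeriv_ofForm_apply X a
    rw [hb]
    cases p with
    | zero => rw [augment_ofForm_zero, augment_ofForm_zero, h]; simp
    | succ p => simp [augment_ofForm_succ]

/-- In the bracket sum for `L_X`, the slot occupied by `Y` produces the contraction with `⁅X, Y⁆`;
the other slots belong to the Lie derivative of the contracted form. -/
theorem interior_lieDeriv (X Y : VField A) (x : Forms A) :
    interior Y (lieDeriv X x) = lieDeriv X (interior Y x) - interior ⁅X, Y⁆ x := by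
  induction x using Forms.induction with
  | h0 => simp
  | hadd x y hx hy => simp only [map_add, hx, hy]; abel
  | hof p a =>
    obtain ⟨b, hb, h⟩ := lieDeriv_ofForm_apply X a
    rw [hb]
    cases p with
    | zero => simp
    | succ p =>
      obtain ⟨c, hc, h'⟩ := lieDeriv_ofForm_apply X (a.curryLeft Y)
      rw [interior_ofForm_succ, interior_ofForm_succ, interior_ofForm_succ, hc, ← map_sub]
      congr 1
      ext v
      rw [AlternatingMap.sub_apply, h', AlternatingMap.curryLeft_apply_apply, h, Fin.sum_univ_succ]
      simp only [AlternatingMap.curryLeft_apply_apply, Matrix.cons_val_zero, Matrix.cons_val_succ]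
      have h2 (i : Fin p) (Z : VField A) :
          Function.update (Matrix.vecCons Y v : Fin (p + 1) → VField A) i.succ Z =
            Matrix.vecCons Y (Function.update v i Z) :=
        (Fin.cons_update (α := fun _ => VField A) Y v i Z).symm
      have h3 (Z : VField A) : Function.update (Matrix.vecCons Y v : Fin (p + 1) → VField A) 0 Z =
          Matrix.vecCons Z v :=
        Fin.update_cons_zero (α := fun _ => VField A) Y v Z
      simp only [h2, h3]
      ring

/-- The contributions of `⁅X, Y⁆` cancel because contraction is an antiderivation, so the failure of
the rule contracts to failures for `(ι_Y x, y)` and `(bar x, ι_Y y)`. -/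
theorem lieDeriv_mul (X : VField A) (x y : Forms A) :
    lieDeriv X (x * y) = lieDeriv X x * y + x * lieDeriv X y := by
  have h := eq_zero_of_interior_mem_span
    (fun t : Forms A × Forms A =>
      lieDeriv X (t.1 * t.2) - (lieDeriv X t.1 * t.2 + t.1 * lieDeriv X t.2))
    (fun t => by
      simp only [map_sub, map_add, augment_mul, augment_lieDeriv, Derivation.leibniz, smul_eq_mul]
      ring)
    (fun Y ⟨x, y⟩ => by
      have : interior Y (lieDeriv X (x * y) - (lieDeriv X x * y + x * lieDeriv X y)) =
          (lieDeriv X (interior Y x * y) -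
            (lieDeriv X (interior Y x) * y + interior Y x * lieDeriv X y)) +
          (lieDeriv X (bar x * interior Y y) -
            (lieDeriv X (bar x) * interior Y y + bar x * lieDeriv X (interior Y y))) := by
        simp only [map_sub, map_add, interior_mul, interior_lieDeriv, bar_lieDeriv, sub_mul, mul_sub]
        abel
      simp only [this]
      exact add_mem (mem_span_range (interior Y x, y)) (mem_span_range (bar x, interior Y y)))
    (x, y)
  exact sub_eq_zero.1 h

theorem interior_d (X : VField A) (x : Forms A) :
    interior X (𝒹 x) = lieDeriv X x - 𝒹 (interior X x) := by
  rw [lieDeriv_apply, add_sub_cancel_right]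

/-- The exterior derivative is an antiderivation. -/
theorem d_mul (x y : Forms A) : 𝒹 (x * y) = 𝒹 x * y + bar x * 𝒹 y := by
  have h := eq_zero_of_interior_mem_span
    (fun t : Forms A × Forms A => 𝒹 (t.1 * t.2) - (𝒹 t.1 * t.2 + bar t.1 * 𝒹 t.2))
    (fun t => by simp [augment_mul, augment_d])
    (fun X ⟨x, y⟩ => by
      have : interior X (𝒹 (x * y) - (𝒹 x * y + bar x * 𝒹 y)) =
          -(𝒹 (interior X x * y) - (𝒹 (interior X x) * y + bar (interior X x) * 𝒹 y)) +
          -(𝒹 (bar x * interior X y) -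
            (𝒹 (bar x) * interior X y + bar (bar x) * 𝒹 (interior X y))) := by
        simp only [map_sub, map_add, interior_mul, interior_d, lieDeriv_mul, sub_mul, mul_sub,
          interior_bar, bar_d, bar_bar, neg_mul]
        abel
      simp only [this]
      exact add_mem (neg_mem (mem_span_range (interior X x, y)))
        (neg_mem (mem_span_range (bar x, interior X y))))
    (x, y)
  exact sub_eq_zero.1 h

theorem interior_add (X Y : VField A) (x : Forms A) :
    interior (X + Y) x = interior X x + interior Y x := by
  refine forms_ext fun p => ?_
  simp [component_interior]

/-- On functions this is the definition of the commutator. Under contraction with `Z` the double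
brackets cancel by the Jacobi identity. -/
theorem lieDeriv_lieDeriv (X Y : VField A) (x : Forms A) :
    lieDeriv X (lieDeriv Y x) = lieDeriv Y (lieDeriv X x) + lieDeriv ⁅X, Y⁆ x := by
  have h := eq_zero_of_interior_mem_span
    (fun x : Forms A =>
      lieDeriv X (lieDeriv Y x) - (lieDeriv Y (lieDeriv X x) + lieDeriv ⁅X, Y⁆ x))
    (fun t => by
      simp [augment_lieDeriv, Derivation.commutator_apply])
    (fun Z x => by
      have : interior Z
            (lieDeriv X (lieDeriv Y x) - (lieDeriv Y (lieDeriv X x) + lieDeriv ⁅X, Y⁆ x)) =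
          lieDeriv X (lieDeriv Y (interior Z x)) -
            (lieDeriv Y (lieDeriv X (interior Z x)) + lieDeriv ⁅X, Y⁆ (interior Z x)) := by
        have hj : interior ⁅X, ⁅Y, Z⁆⁆ x =
            interior ⁅⁅X, Y⁆, Z⁆ x + interior ⁅Y, ⁅X, Z⁆⁆ x := by
          rw [← interior_add, leibniz_lie]
        simp only [map_sub, map_add, interior_lieDeriv, hj]
        abel
      simp only [this]
      exact mem_span_range (interior Z x))
    x
  exact sub_eq_zero.1 h

/-- Deriving this from `[L_X, L_Y] = L_[X,Y]` rather than from `d² = 0` lets it serve as the input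
for `d_d`. -/
theorem lieDeriv_d (X : VField A) (x : Forms A) : lieDeriv X (𝒹 x) = 𝒹 (lieDeriv X x) := by
  have h := eq_zero_of_interior_mem_span
    (fun x : Forms A => lieDeriv X (𝒹 x) - 𝒹 (lieDeriv X x))
    (fun t => by simp [augment_lieDeriv, augment_d])
    (fun Y x => by
      have : interior Y (lieDeriv X (𝒹 x) - 𝒹 (lieDeriv X x)) =
          -(lieDeriv X (𝒹 (interior Y x)) - 𝒹 (lieDeriv X (interior Y x))) := by
        simp only [map_sub, interior_lieDeriv, interior_d, lieDeriv_lieDeriv X Y]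
        abel
      simp only [this]
      exact neg_mem (mem_span_range (interior Y x)))
    x
  exact sub_eq_zero.1 h

theorem d_d (x : Forms A) : 𝒹 (𝒹 x) = 0 :=
  eq_zero_of_interior_mem_span (fun x : Forms A => 𝒹 (𝒹 x)) (fun t => augment_d _)
    (fun X x => by
      have : interior X (𝒹 (𝒹 x)) = 𝒹 (𝒹 (interior X x)) := by
        simp only [interior_d, map_sub, lieDeriv_d]
        abel
      simp only [this]
      exact mem_span_range (interior X x))
    x

end Cartan

/-! ### Graded derivations, their commutators, and forms as a module over functions. -/

section Derivations

variable {A : Type*} [CommRing A] [Algebra ℝ A]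

local notation "𝒹" => deRhamD A

theorem IsHomogeneous.eq_ofForm {k : ℤ} {D : Module.End ℝ (Forms A)} (h : IsHomogeneous A k D)
    {p q : ℕ} (a : Form A p) (hq : (q : ℤ) = p + k) :
    D (ofForm p a) = ofForm q (component q (D (ofForm p a))) := by
  refine forms_ext fun r => ?_
  by_cases hr : q = r
  · subst hr; rw [component_ofForm_self]
  · rw [component_ofForm_of_ne hr, h p a r (by omega)]

theorem IsHomogeneous.eq_zero {k : ℤ} {D : Module.End ℝ (Forms A)} (h : IsHomogeneous A k D)
    {p : ℕ} (a : Form A p) (hp : (p : ℤ) + k < 0) : D (ofForm p a) = 0 := by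
  refine forms_ext fun r => ?_
  rw [h p a r (by omega), map_zero]

theorem IsHomogeneous.exists_ofForm {k : ℤ} {D : Module.End ℝ (Forms A)} (h : IsHomogeneous A k D)
    {p : ℕ} (a : Form A p) :
    D (ofForm p a) = 0 ∨ ∃ (q : ℕ) (b : Form A q), (q : ℤ) = p + k ∧ D (ofForm p a) = ofForm q b := by
  by_cases hp : (p : ℤ) + k < 0
  · exact Or.inl (h.eq_zero a hp)
  · obtain ⟨q, hq⟩ := Int.eq_ofNat_of_zero_le (not_lt.1 hp)
    exact Or.inr ⟨q, _, hq.symm, h.eq_ofForm a hq.symm⟩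

theorem isHomogeneous_of_exists {k : ℤ} {D : Module.End ℝ (Forms A)}
    (h : ∀ (p : ℕ) (a : Form A p), D (ofForm p a) = 0 ∨
      ∃ (q : ℕ) (b : Form A q), (q : ℤ) = p + k ∧ D (ofForm p a) = ofForm q b) :
    IsHomogeneous A k D := by
  intro p a r hr
  rcases h p a with h0 | ⟨q, b, hq, hb⟩
  · rw [h0, map_zero]
  · rw [hb, component_ofForm_of_ne (by omega)]

theorem IsHomogeneous.mul {k l : ℤ} {D D' : Module.End ℝ (Forms A)} (h : IsHomogeneous A k D)
    (h' : IsHomogeneous A l D') : IsHomogeneous A (l + k) (D * D') := by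
  refine isHomogeneous_of_exists fun p a => ?_
  rw [Module.End.mul_apply]
  rcases h'.exists_ofForm a with h0 | ⟨q, b, hq, hb⟩
  · left; rw [h0, map_zero]
  · rw [hb]
    rcases h.exists_ofForm b with h0 | ⟨r, c, hr, hc⟩
    · exact Or.inl h0
    · exact Or.inr ⟨r, c, by omega, hc⟩

theorem IsHomogeneous.sub {k : ℤ} {D D' : Module.End ℝ (Forms A)} (h : IsHomogeneous A k D)
    (h' : IsHomogeneous A k D') : IsHomogeneous A k (D - D') := fun p a q hq => by
  rw [LinearMap.sub_apply, map_sub, h p a q hq, h' p a q hq, sub_zero]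

theorem IsHomogeneous.add {k : ℤ} {D D' : Module.End ℝ (Forms A)} (h : IsHomogeneous A k D)
    (h' : IsHomogeneous A k D') : IsHomogeneous A k (D + D') := fun p a q hq => by
  rw [LinearMap.add_apply, map_add, h p a q hq, h' p a q hq, add_zero]

theorem IsHomogeneous.smul {k : ℤ} {D : Module.End ℝ (Forms A)} (h : IsHomogeneous A k D)
    (r : ℝ) : IsHomogeneous A k (r • D) := fun p a q hq => by
  rw [LinearMap.smul_apply, map_smul, h p a q hq, smul_zero]

theorem IsHomogeneous.units_smul {k : ℤ} {D : Module.End ℝ (Forms A)} (h : IsHomogeneous A k D)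
    (u : ℤˣ) : IsHomogeneous A k (u • D) := by
  rcases Int.units_eq_one_or u with e | e
  · simpa [e] using h
  · intro p a q hq
    simp [e, h p a q hq]

theorem bar_ofForm_eq_negOnePow {p : ℕ} (a : Form A p) :
    bar (ofForm p a) = (p : ℤ).negOnePow • ofForm p a := by
  rw [bar_ofForm]
  rcases Nat.even_or_odd p with h | h
  · rw [h.neg_one_pow, Int.negOnePow_even _ (by exact_mod_cast h), one_smul, one_smul]
  · rw [h.neg_one_pow, Int.negOnePow_odd _ (by exact_mod_cast h), Units.neg_smul, one_smul,
      neg_one_smul]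

theorem d_mem_der : 𝒹 ∈ Der A 1 :=
  ⟨isHomogeneous_of_exists fun p a => Or.inr ⟨p + 1, _, by push_cast; ring, deRhamD_ofForm A a⟩,
    fun p a b => by rw [d_mul, bar_ofForm_eq_negOnePow, one_mul, smul_mul_assoc]⟩

theorem d_mul_d : 𝒹 * 𝒹 = 0 := LinearMap.ext d_d

theorem gradedComm_apply (Q : Module.End ℝ (Forms A)) (k : ℤ) (D : Module.End ℝ (Forms A))
    (x : Forms A) : gradedComm Q k D x = Q (D x) - k.negOnePow • D (Q x) := by
  rcases Int.units_eq_one_or k.negOnePow with e | e <;> simp [gradedComm, e]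

theorem map_units_smul_form (D : Module.End ℝ (Forms A)) (u : ℤˣ) (x : Forms A) :
    D (u • x) = u • D x := by
  rcases Int.units_eq_one_or u with e | e <;> simp [e]

theorem gradedComm_mem_der {Q : Module.End ℝ (Forms A)} (hQ : Q ∈ Der A 1) {k : ℤ}
    {D : Module.End ℝ (Forms A)} (hD : D ∈ Der A k) : gradedComm Q k D ∈ Der A (k + 1) := by
  refine ⟨?_, fun p a b => ?_⟩
  · rw [gradedComm]
    refine (hQ.1.mul hD.1).sub (IsHomogeneous.units_smul ?_ _)
    rw [add_comm]
    exact hD.1.mul hQ.1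
  · have h1 : Q (D (ofForm p a) * b) = Q (D (ofForm p a)) * b +
        ((p : ℤ).negOnePow * k.negOnePow) • (D (ofForm p a) * Q b) := by
      rcases hD.1.exists_ofForm a with h0 | ⟨q, c, hq, hc⟩
      · simp [h0]
      · rw [hc, hQ.2, one_mul, hq, Int.negOnePow_add]
    have h2 : D (Q (ofForm p a) * b) = D (Q (ofForm p a)) * b +
        ((k * p).negOnePow * k.negOnePow) • (Q (ofForm p a) * D b) := by
      rcases hQ.1.exists_ofForm a with h0 | ⟨q, c, hq, hc⟩
      · simp [h0]
      · rw [hc, hD.2, hq, mul_add, mul_one, Int.negOnePow_add]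
    simp only [gradedComm_apply]
    rw [hD.2, hQ.2, map_add, map_add, h1, h2, map_units_smul_form, map_units_smul_form, hQ.2, hD.2, add_mul,
      one_mul, Int.negOnePow_add]
    rcases Int.units_eq_one_or k.negOnePow with e | e <;>
      rcases Int.units_eq_one_or (p : ℤ).negOnePow with e' | e' <;>
      rcases Int.units_eq_one_or (k * p).negOnePow with e'' | e'' <;>
      simp only [e, e', e'', one_smul, mul_one, Units.neg_smul, sub_mul, mul_sub, mul_neg,
        neg_neg, neg_mul] <;> abel

theorem gradedComm_gradedComm {Q : Module.End ℝ (Forms A)} (hQ : Q * Q = 0) (k : ℤ)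
    (D : Module.End ℝ (Forms A)) : gradedComm Q (k + 1) (gradedComm Q k D) = 0 := by
  have h (x : Forms A) : Q (Q x) = 0 := LinearMap.congr_fun hQ x
  refine LinearMap.ext fun x => ?_
  simp only [gradedComm_apply, Int.negOnePow_add, map_sub, map_units_smul_form, h, map_zero]
  rcases Int.units_eq_one_or k.negOnePow with e | e <;> simp [e]

theorem isLieAlgebroid_d : IsLieAlgebroid A 𝒹 := ⟨d_mem_der, d_mul_d⟩

theorem isDeformationComplex_d : IsDeformationComplex A 𝒹 := fun k _ hD =>
  ⟨gradedComm_mem_der d_mem_der hD, gradedComm_gradedComm d_mul_d k _⟩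

theorem component_mul_ofForm (x : Forms A) (p : ℕ) {q : ℕ} (b : Form A q) :
    component (p + q) (x * ofForm q b) = wedge (component p x) b := by
  induction x using Forms.induction with
  | h0 => rw [zero_mul, map_zero, map_zero, wedge_zero_left]
  | hadd x y hx hy => rw [add_mul, map_add, map_add, wedge_add_left, hx, hy]
  | hof r a =>
    rw [ofForm_mul_ofForm]
    by_cases h : r = p
    · subst h; rw [component_ofForm_self, component_ofForm_self]
    · rw [component_ofForm_of_ne h, component_ofForm_of_ne (by omega), wedge_zero_left]

theorem component_ofForm_mul {p : ℕ} (a : Form A p) (y : Forms A) (q : ℕ) :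
    component (p + q) (ofForm p a * y) = wedge a (component q y) := by
  induction y using Forms.induction with
  | h0 => rw [mul_zero, map_zero, map_zero, wedge_zero_right]
  | hadd x y hx hy => rw [mul_add, map_add, map_add, wedge_add_right, hx, hy]
  | hof r b =>
    rw [ofForm_mul_ofForm]
    by_cases h : r = q
    · subst h; rw [component_ofForm_self, component_ofForm_self]
    · rw [component_ofForm_of_ne h, component_ofForm_of_ne (by omega), wedge_zero_right]

theorem component_fn_mul (f : A) (p : ℕ) (x : Forms A) :
    component p (fn A f * x) = f • component p x := by
  induction x using Forms.induction with
  | h0 => simp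
  | hadd x y hx hy => rw [mul_add, map_add, map_add, smul_add, hx, hy]
  | hof q a =>
    rw [fn_mul_ofForm]
    by_cases h : q = p
    · subst h; rw [component_ofForm_self, component_ofForm_self]
    · rw [component_ofForm_of_ne h, component_ofForm_of_ne h, smul_zero]

theorem interior_smul (f : A) (X : VField A) (x : Forms A) :
    interior (f • X) x = fn A f * interior X x := by
  refine forms_ext fun p => ?_
  rw [component_fn_mul, component_interior, component_interior, map_smul]

theorem interior_sum {ι : Type*} (s : Finset ι) (X : ι → VField A) (x : Forms A) :
    interior (∑ i ∈ s, X i) x = ∑ i ∈ s, interior (X i) x := by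
  refine forms_ext fun p => ?_
  simp only [component_interior, map_sum]

theorem interior_self (X : VField A) (x : Forms A) : interior X (interior X x) = 0 := by
  refine forms_ext fun p => ?_
  rw [component_interior, component_interior, AlternatingMap.curryLeft_same, map_zero]

theorem interior_comm (X Y : VField A) (x : Forms A) :
    interior X (interior Y x) = -interior Y (interior X x) := by
  have h := interior_self (X + Y) x
  rw [interior_add, interior_add, map_add, map_add, interior_self, interior_self,
    zero_add, add_zero] at h
  exact eq_neg_of_add_eq_zero_left h

theorem der_fn_mul {k : ℤ} {D : Module.End ℝ (Forms A)} (hD : D ∈ Der A k) (f : A) (x : Forms A) :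
    D (fn A f * x) = D (fn A f) * x + fn A f * D x := by
  rw [fn]
  refine (hD.2 0 _ x).trans ?_
  simp

theorem d_fn_eq (f : A) : 𝒹 (fn A f) = ofForm 1 (component 1 (𝒹 (fn A f))) :=
  d_mem_der.1.eq_ofForm _ (by simp)

end Derivations

/-! ### Local frames, insertions of vector valued forms, and acyclicity. -/

/-- Functions `coord i` and vector fields `field i` that are dual to each other, in the sense that
`X g = ∑ i, X (coord i) * field i g`, with a summation operator `glue` that is given locally, that
is after multiplication with a `cutoff` function, by finite linear combinations. -/
structure LocalFrame (A : Type*) [CommRing A] [Algebra ℝ A] where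
  ι : Type*
  coord : ι → A
  field : ι → VField A
  glue : (ι → A) →ₗ[A] A
  expand : ∀ (X : VField A) (g : A), X g = glue fun i => X (coord i) * field i g
  cutoff : Set A
  eq_zero : ∀ f : A, (∀ ψ ∈ cutoff, ψ * f = 0) → f = 0
  finite : ∀ ψ ∈ cutoff, ∃ (s : Finset ι) (c : ι → A), ∀ g, ψ * glue g = ∑ i ∈ s, c i * g i

theorem derivation_sum_apply {A : Type*} [CommRing A] [Algebra ℝ A] {ι : Type*} (s : Finset ι)
    (X : ι → VField A) (g : A) : (∑ i ∈ s, X i) g = ∑ i ∈ s, X i g := by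
  classical
  induction s using Finset.induction_on with
  | empty => simp
  | insert i s hi ih => rw [Finset.sum_insert hi, Finset.sum_insert hi, Derivation.add_apply, ih]

namespace LocalFrame

variable {A : Type*} [CommRing A] [Algebra ℝ A] (B : LocalFrame A)

local notation "𝒹" => deRhamD A

theorem forms_eq_zero (B : LocalFrame A) {x : Forms A} (h : ∀ ψ ∈ B.cutoff, fn A ψ * x = 0) :
    x = 0 := by
  refine forms_ext fun p => ?_
  ext v
  refine B.eq_zero _ fun ψ hψ => ?_
  have := congrArg (fun y => component p y v) (h ψ hψ)
  simpa [component_fn_mul] using this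

/-- This is Euler's identity `p a = ∑ dx_i ∧ ι_(∂_i) a`, localised by a cutoff. Contracting the
right side with `X` gives `ψ ι_X a`, by the frame expansion of `X`, plus the same sum for `ι_X a`,
so the multiplicity grows by one with each degree. -/
theorem mul_ofForm_eq_sum {ψ : A} {s : Finset B.ι} {c : B.ι → A}
    (hc : ∀ g, ψ * B.glue g = ∑ i ∈ s, c i * g i) {p : ℕ} (a : Form A p) :
    fn A ψ * (p • ofForm p a) = ∑ i ∈ s,
      fn A (c i) * (𝒹 (fn A (B.coord i)) * interior (B.field i) (ofForm p a)) := by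
  induction p with
  | zero => simp
  | succ p ih =>
    refine forms_eq_of_interior ?_ fun X => ?_
    · simp [augment_mul, augment_d, augment_ofForm_succ]
    · have hX : ψ • X = ∑ i ∈ s, (c i * X (B.coord i)) • B.field i := by
        ext g
        rw [Derivation.smul_apply, smul_eq_mul, B.expand X g, hc]
        simp [derivation_sum_apply, mul_assoc]
      have h1 : fn A ψ * interior X (ofForm (p + 1) a) =
          ∑ i ∈ s, fn A (c i) * (fn A (X (B.coord i)) *
            interior (B.field i) (ofForm (p + 1) a)) := by
        rw [← interior_smul, hX, interior_sum]
        simp only [interior_smul, fn_mul, forms_mul_assoc]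
      have h2 := ih (a.curryLeft X)
      rw [← interior_ofForm_succ] at h2
      rw [interior_mul, interior_fn, zero_mul, zero_add, bar_fn, map_nsmul, succ_nsmul, mul_add, h1,
        h2, map_sum, ← Finset.sum_add_distrib]
      refine Finset.sum_congr rfl fun i _ => ?_
      rw [interior_mul, interior_mul, interior_fn, interior_d_fn, bar_fn, bar_d, bar_fn,
        interior_comm X (B.field i), zero_mul, zero_add, ← mul_add]
      congr 1
      simp only [neg_mul, mul_neg, neg_neg]
      exact add_comm _ _

/-- Vanishing on functions makes `D` linear over functions. Applied to Euler's identity, each term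
contains `D(dx_i)` or `D` of a form of lower degree; induction on the degree, division by it, and
separation by cutoffs finish the argument. -/
theorem der_eq_zero {k : ℤ} {D : Module.End ℝ (Forms A)} (hD : D ∈ Der A k)
    (h0 : ∀ f, D (fn A f) = 0) (h1 : ∀ f, D (𝒹 (fn A f)) = 0) (B : LocalFrame A) : D = 0 := by
  refine end_ext fun p a => ?_
  rw [LinearMap.zero_apply]
  have hfn (f : A) (x : Forms A) : D (fn A f * x) = fn A f * D x := by
    rw [der_fn_mul hD, h0, zero_mul, zero_add]
  induction p with
  | zero => rw [ofForm_zero_eq, h0]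
  | succ p ih =>
    refine B.forms_eq_zero fun ψ hψ => ?_
    obtain ⟨s, c, hc⟩ := B.finite ψ hψ
    have h := congrArg D (B.mul_ofForm_eq_sum hc a)
    rw [hfn, map_nsmul, map_sum, Finset.sum_eq_zero, mul_smul_comm] at h
    · exact nsmul_cancel (Nat.succ_ne_zero p) (h.trans (smul_zero _).symm)
    · intro i _
      rw [hfn, interior_ofForm_succ, d_fn_eq, hD.2, ← d_fn_eq, h1, ih, mul_zero, zero_mul,
        smul_zero, add_zero, mul_zero]

/-- The operator `glue`, on forms. -/
def glueForm {p : ℕ} (a : B.ι → Form A p) : Form A p :=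
  B.glue.compAlternatingMap (AlternatingMap.pi a)

theorem glueForm_apply {p : ℕ} (a : B.ι → Form A p) (v : Fin p → VField A) :
    B.glueForm a v = B.glue fun i => a i v := rfl

/-- The exterior product is a finite sum of products of values, up to a factorial, so linearity of
`glue` over functions suffices even for an infinite family. -/
theorem wedge_glueForm_left {p q : ℕ} (a : B.ι → Form A p) (b : Form A q) :
    wedge (B.glueForm a) b = B.glueForm fun i => wedge (a i) b := by
  have hr (g : B.ι → A) (f : A) : B.glue g * f = B.glue fun i => g i * f := by
    rw [mul_comm, ← smul_eq_mul, ← map_smul]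
    congr 1
    funext i
    exact mul_comm _ _
  ext v
  refine nsmul_cancel (n := p.factorial * q.factorial) (by positivity) ?_
  rw [wedge_apply_factorial, glueForm_apply, ← map_nsmul]
  have : ((p.factorial * q.factorial) • fun i => wedge (a i) b v) =
      ∑ σ : Equiv.Perm (Fin (p + q)), Equiv.Perm.sign σ • fun i =>
        (a i (fun k => v (σ (Fin.castAdd q k))) * b (fun k => v (σ (Fin.natAdd p k)))) := by
    funext i
    rw [Pi.smul_apply, wedge_apply_factorial, Finset.sum_apply]
    rfl
  rw [this, map_sum]
  refine Finset.sum_congr rfl fun σ _ => ?_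
  rw [glueForm_apply, hr]
  rcases Int.units_eq_one_or (Equiv.Perm.sign σ) with e | e <;> simp [e]

theorem wedge_glueForm_right {p q : ℕ} (a : Form A p) (b : B.ι → Form A q) :
    wedge a (B.glueForm b) = B.glueForm fun i => wedge a (b i) := by
  have hr (g : B.ι → A) (f : A) : f * B.glue g = B.glue fun i => f * g i := by
    rw [← smul_eq_mul, ← map_smul]
    rfl
  ext v
  refine nsmul_cancel (n := p.factorial * q.factorial) (by positivity) ?_
  rw [wedge_apply_factorial, glueForm_apply, ← map_nsmul]
  have : ((p.factorial * q.factorial) • fun i => wedge a (b i) v) =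
      ∑ σ : Equiv.Perm (Fin (p + q)), Equiv.Perm.sign σ • fun i =>
        (a (fun k => v (σ (Fin.castAdd q k))) * b i (fun k => v (σ (Fin.natAdd p k)))) := by
    funext i
    rw [Pi.smul_apply, wedge_apply_factorial, Finset.sum_apply]
    rfl
  rw [this, map_sum]
  refine Finset.sum_congr rfl fun σ _ => ?_
  rw [glueForm_apply, hr]
  rcases Int.units_eq_one_or (Equiv.Perm.sign σ) with e | e <;> simp [e]

/-- The operator `glue`, on the components of degree `n` of a family of forms. -/
def glueDegree (n : ℕ) : (B.ι → Forms A) →ₗ[ℝ] Forms A where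
  -- An infinite family in a direct sum may have unbounded degrees, so glueing is done in one degree
  -- at a time.
  toFun x := ofForm n (B.glueForm fun i => component n (x i))
  map_add' x y := by
    rw [← map_add]
    congr 1
    ext v
    rw [AlternatingMap.add_apply, glueForm_apply, glueForm_apply, glueForm_apply, ← map_add]
    simp only [Pi.add_apply, map_add (component n), AlternatingMap.add_apply]
    rfl
  map_smul' r x := by
    rw [RingHom.id_apply, ← map_smul]
    congr 1
    ext v
    rw [AlternatingMap.smul_apply, glueForm_apply, glueForm_apply, ← LinearMap.map_smul_of_tower]
    simp only [Pi.smul_apply, map_smul, AlternatingMap.smul_apply]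
    rfl

theorem glueDegree_apply (n : ℕ) (x : B.ι → Forms A) :
    B.glueDegree n x = ofForm n (B.glueForm fun i => component n (x i)) := rfl

theorem glueDegree_mul (n : ℕ) (x : B.ι → Forms A) {q : ℕ} (b : Form A q) :
    B.glueDegree (n + q) (fun i => x i * ofForm q b) = B.glueDegree n x * ofForm q b := by
  simp only [glueDegree_apply, component_mul_ofForm]
  rw [ofForm_mul_ofForm, wedge_glueForm_left]

theorem mul_glueDegree {p : ℕ} (a : Form A p) (n : ℕ) (x : B.ι → Forms A) :
    B.glueDegree (p + n) (fun i => ofForm p a * x i) = ofForm p a * B.glueDegree n x := by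
  simp only [glueDegree_apply, component_ofForm_mul]
  rw [ofForm_mul_ofForm, wedge_glueForm_right]

/-- The insertion `∑ i, κ i ∧ ι(field i)` of the vector valued `m`-form `∑ i, κ i ⊗ field i`. -/
def insertion {m : ℕ} (κ : B.ι → Form A m) : Module.End ℝ (Forms A) :=
  -- The subtraction truncates only for `m = p = 0`, where the contraction of a function is zero
  -- anyway.
  DirectSum.toModule ℝ ℕ (Forms A) fun p => B.glueDegree (m + p - 1) ∘ₗ
    LinearMap.pi fun i => LinearMap.mulLeft ℝ (ofForm m (κ i)) ∘ₗ interior (B.field i) ∘ₗ ofForm p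

theorem insertion_ofForm {m : ℕ} (κ : B.ι → Form A m) {p : ℕ} (a : Form A p) :
    B.insertion κ (ofForm p a) = B.glueDegree (m + p - 1)
      fun i => ofForm m (κ i) * interior (B.field i) (ofForm p a) :=
  DirectSum.toModule_lof (M := fun p : ℕ => Form A p) ℝ p a

theorem glueDegree_zero (n : ℕ) : B.glueDegree n (fun _ => 0) = 0 := map_zero (B.glueDegree n)

/-- Contraction passes `a` with sign `(-1)^p` and `κ i` passes `a` with sign `(-1)^(mp)`; together
they give `(-1)^((m-1)p)`. Glueing commutes with exterior multiplication on either side. -/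
theorem insertion_mul_ofForm {m : ℕ} (κ : B.ι → Form A m) {p q : ℕ} (a : Form A p) (b : Form A q) :
    B.insertion κ (ofForm p a * ofForm q b) = B.insertion κ (ofForm p a) * ofForm q b +
      (((m : ℤ) - 1) * p).negOnePow • (ofForm p a * B.insertion κ (ofForm q b)) := by
  have h1 : B.glueDegree (m + (p + q) - 1)
      (fun i => ofForm m (κ i) * (interior (B.field i) (ofForm p a) * ofForm q b)) =
      B.insertion κ (ofForm p a) * ofForm q b := by
    rw [insertion_ofForm]
    cases p with
    | zero => simp [glueDegree_zero]
    | succ p =>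
      rw [← glueDegree_mul]
      simp only [forms_mul_assoc]
      congr 2
      omega
  have h2 : B.glueDegree (m + (p + q) - 1)
      (fun i => ofForm m (κ i) * (bar (ofForm p a) * interior (B.field i) (ofForm q b))) =
      (((m : ℤ) - 1) * p).negOnePow • (ofForm p a * B.insertion κ (ofForm q b)) := by
    rw [insertion_ofForm]
    cases q with
    | zero => simp [glueDegree_zero]
    | succ q =>
      have hbar (i : B.ι) : ofForm m (κ i) * ofForm p a =
          (m * p : ℤ).negOnePow • (ofForm p a * ofForm m (κ i)) := by
        have hb (j : ℕ) (z : ℤ) : (bar ^ j) (ofForm p a) = (j * p : ℤ).negOnePow • ofForm p a := by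
          induction j with
          | zero => simp
          | succ j ih =>
            rw [pow_succ', Module.End.mul_apply, ih, map_units_smul_form, bar_ofForm_eq_negOnePow,
              smul_smul, ← Int.negOnePow_add]
            push_cast
            ring_nf
        rw [ofForm_mul_comm, hb m 0]
        rcases Int.units_eq_one_or (m * p : ℤ).negOnePow with e | e <;> simp [e]
      have hs (i : B.ι) : ofForm m (κ i) *
            (bar (ofForm p a) * interior (B.field i) (ofForm (q + 1) b)) =
          (((m : ℤ) - 1) * p).negOnePow •
            (ofForm p a * (ofForm m (κ i) * interior (B.field i) (ofForm (q + 1) b))) := by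
        rw [← forms_mul_assoc, bar_ofForm_eq_negOnePow, ← forms_mul_assoc,
          show ((m : ℤ) - 1) * p = m * p - p by ring, Int.negOnePow_sub]
        rcases Int.units_eq_one_or (m * p : ℤ).negOnePow with e | e <;>
          rcases Int.units_eq_one_or (p : ℤ).negOnePow with e' | e' <;>
          simp [hbar, e, e']
      simp only [hs]
      rw [← mul_glueDegree, show m + (p + (q + 1)) - 1 = p + (m + (q + 1) - 1) by omega]
      rcases Int.units_eq_one_or (((m : ℤ) - 1) * p).negOnePow with e | e
      · simp [e]
      · simp only [e, Units.neg_smul, one_smul]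
        exact map_neg (B.glueDegree _) _
  rw [ofForm_mul_ofForm, insertion_ofForm, ← h1, ← h2, ← map_add]
  congr 1
  funext i
  rw [← ofForm_mul_ofForm, interior_mul, mul_add]
  rfl

theorem insertion_mem_der {m : ℕ} (κ : B.ι → Form A m) : B.insertion κ ∈ Der A ((m : ℤ) - 1) := by
  refine ⟨isHomogeneous_of_exists fun p a => ?_, fun p a y => ?_⟩
  · rw [insertion_ofForm]
    cases p with
    | zero => left; simp [glueDegree_zero]
    | succ p => exact Or.inr ⟨m + (p + 1) - 1, _, by push_cast; omega, rfl⟩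
  · induction y using Forms.induction with
    | h0 => simp
    | hadd x y hx hy => simp only [mul_add, map_add, hx, hy, smul_add]; abel
    | hof q b => exact B.insertion_mul_ofForm κ a b

theorem insertion_fn {m : ℕ} (κ : B.ι → Form A m) (f : A) : B.insertion κ (fn A f) = 0 := by
  rw [fn]
  refine (B.insertion_ofForm κ _).trans ?_
  simp [glueDegree_zero]

/-- For fixed arguments `v`, the map `g ↦ (D g)(v)` is a derivation of functions, that is, a vector
field. Its expansion in the frame, applied to `f`, is the asserted equality evaluated at `v`. -/
theorem insertion_d_fn {m : ℕ} {D : Module.End ℝ (Forms A)} (hD : D ∈ Der A m) (f : A) :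
    B.insertion (fun i => component m (D (fn A (B.coord i)))) (𝒹 (fn A f)) = D (fn A f) := by
  have hhom (g : A) : D (fn A g) = ofForm m (component m (D (fn A g))) :=
    hD.1.eq_ofForm _ (by simp)
  rw [d_fn_eq, insertion_ofForm, ← d_fn_eq, hhom, glueDegree_apply]
  congr 1
  ext v
  let X : VField A := Derivation.mk'
    { toFun := fun g => component m (D (fn A g)) v
      map_add' := fun g h => by simp
      map_smul' := fun r g => by simp }
    (fun g h => by
      change component m (D (fn A (g * h))) v = g * component m (D (fn A h)) v +
        h * component m (D (fn A g)) v
      rw [fn_mul, der_fn_mul hD, ← fn_comm, map_add, component_fn_mul, component_fn_mul,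
        AlternatingMap.add_apply, AlternatingMap.smul_apply, AlternatingMap.smul_apply,
        smul_eq_mul, smul_eq_mul, add_comm])
  have hX (g : A) : X g = component m (D (fn A g)) v := rfl
  rw [glueForm_apply, ← hX, B.expand X f]
  congr 1
  funext i
  rw [interior_d_fn, ← hhom, ← fn_comm, component_fn_mul, AlternatingMap.smul_apply]
  exact mul_comm _ _

/-- The deformation complex of the de Rham differential is acyclic. -/
theorem isAcyclicDeformationComplex (B : LocalFrame A) : IsAcyclicDeformationComplex A 𝒹 := by
  intro k D hD h
  have hc (x : Forms A) : 𝒹 (D x) = k.negOnePow • D (𝒹 x) := by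
    have := LinearMap.congr_fun h x
    rw [gradedComm_apply] at this
    exact sub_eq_zero.1 this
  by_cases hk : k < 0
  -- In negative degree there are no nonzero cocycles, so the primitive is `0`.
  · have h0 (f : A) : D (fn A f) = 0 := hD.1.eq_zero _ (by simpa using hk)
    have hD0 : D = 0 := der_eq_zero hD h0 (fun f => by
      have := hc (fn A f)
      rw [h0, map_zero] at this
      exact ((smul_eq_zero_iff_eq _).1 this.symm)) B
    exact ⟨0, Submodule.zero_mem _, by simp [hD0, gradedComm]⟩
  · obtain ⟨m, rfl⟩ := Int.eq_ofNat_of_zero_le (not_lt.1 hk)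
    -- On a function `f`, `[d, E] f = -(-1)^(m-1) E(df) = (-1)^m D f`. The factor `(-1)^m` below
    -- corrects this sign.
    set E := B.insertion (fun i => component m (D (fn A (B.coord i))))
    have hE : (-1 : ℝ) ^ m • E ∈ Der A ((m : ℤ) - 1) :=
      Submodule.smul_mem _ _ (B.insertion_mem_der _)
    have hE0 (f : A) : E (fn A f) = 0 := B.insertion_fn _ f
    have hE1 (f : A) : E (𝒹 (fn A f)) = D (fn A f) := B.insertion_d_fn hD f
    have hs : (-1 : ℝ) ^ m = 1 ∧ (m : ℤ).negOnePow = 1 ∨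
        (-1 : ℝ) ^ m = -1 ∧ (m : ℤ).negOnePow = -1 := by
      rcases Nat.even_or_odd m with h | h
      · exact Or.inl ⟨h.neg_one_pow, Int.negOnePow_even _ (by exact_mod_cast h)⟩
      · exact Or.inr ⟨h.neg_one_pow, Int.negOnePow_odd _ (by exact_mod_cast h)⟩
    refine ⟨_, hE, sub_eq_zero.1 (der_eq_zero (k := (m : ℤ))
      (Submodule.sub_mem _ ?_ hD) (fun f => ?_) (fun f => ?_) B)⟩
    · have := gradedComm_mem_der d_mem_der hE
      rwa [sub_add_cancel] at this
    · rw [LinearMap.sub_apply, gradedComm_apply, LinearMap.smul_apply, LinearMap.smul_apply, hE0, hE1,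
        Int.negOnePow_sub]
      rcases hs with ⟨e, e'⟩ | ⟨e, e'⟩ <;> simp [e, e']
    · rw [LinearMap.sub_apply, gradedComm_apply, LinearMap.smul_apply, LinearMap.smul_apply, hE1, d_d,
        map_zero, smul_zero, smul_zero, sub_zero, map_smul, hc]
      rcases hs with ⟨e, e'⟩ | ⟨e, e'⟩ <;> simp [e, e']

end LocalFrame

/-! ### Formal flows, and rigidity from acyclicity. -/

section Rigidity

variable {A : Type*} [CommRing A] [Algebra ℝ A]

/-- The flow `φ` of a time dependent family `Y` of derivations: the formal solution of
`t φ' = (∑ t^(n+1) Y n) φ` with `φ 0 = 1`. -/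
def formalFlow (Y : ℕ → Module.End ℝ (Forms A)) : ℕ → Module.End ℝ (Forms A)
  | 0 => 1
  | n + 1 => ((n : ℝ) + 1)⁻¹ • ∑ i : Fin (n + 1), Y i * formalFlow Y (n - i)

theorem formalFlow_zero (Y : ℕ → Module.End ℝ (Forms A)) : formalFlow Y 0 = 1 := by
  rw [formalFlow]

theorem formalFlow_succ (Y : ℕ → Module.End ℝ (Forms A)) (n : ℕ) :
    ((n : ℝ) + 1) • formalFlow Y (n + 1) =
      ∑ x ∈ Finset.HasAntidiagonal.antidiagonal n, Y x.1 * formalFlow Y x.2 := by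
  rw [formalFlow, smul_smul, mul_inv_cancel₀ (by positivity), one_smul,
    Finset.Nat.sum_antidiagonal_eq_sum_range_succ (fun i j => Y i * formalFlow Y j),
    Finset.sum_range]

/-- The recursion for order `n` uses only `Y 0, …, Y (n - 1)`. Hence `Y` can be built one
coefficient at a time without disturbing earlier orders. -/
theorem formalFlow_congr {Y Z : ℕ → Module.End ℝ (Forms A)} {n : ℕ} (h : ∀ i < n, Y i = Z i) :
    formalFlow Y n = formalFlow Z n := by
  induction n using Nat.strong_induction_on with
  | _ n ih =>
    cases n with
    | zero => rw [formalFlow_zero, formalFlow_zero]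
    | succ n =>
      rw [formalFlow, formalFlow]
      congr 1
      refine Finset.sum_congr rfl fun i _ => ?_
      rw [h i i.isLt, ih (n - i) (by omega) fun j hj => h j (by omega)]

theorem der_zero_mul {D : Module.End ℝ (Forms A)} (hD : D ∈ Der A 0) (x y : Forms A) :
    D (x * y) = D x * y + x * D y := by
  induction x using Forms.induction with
  | h0 => simp
  | hadd x x' h h' => simp only [add_mul, map_add, h, h']; abel
  | hof p a => simpa using hD.2 p a y

theorem der_one_mul {D : Module.End ℝ (Forms A)} (hD : D ∈ Der A 1) (x y : Forms A) :
    D (x * y) = D x * y + bar x * D y := by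
  induction x using Forms.induction with
  | h0 => simp
  | hadd x x' h h' => simp only [add_mul, map_add, h, h']; abel
  | hof p a =>
    rw [hD.2, bar_ofForm_eq_negOnePow, one_mul]
    rcases Int.units_eq_one_or (p : ℤ).negOnePow with e | e <;> simp [e]

theorem isHomogeneous_one : IsHomogeneous A 0 1 :=
  isHomogeneous_of_exists fun p a => Or.inr ⟨p, a, by simp, rfl⟩

theorem IsHomogeneous.zero (k : ℤ) : IsHomogeneous A k 0 := (Der A k).zero_mem.1

theorem IsHomogeneous.sum {ι : Type*} {k : ℤ} (s : Finset ι) {D : ι → Module.End ℝ (Forms A)}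
    (h : ∀ i ∈ s, IsHomogeneous A k (D i)) : IsHomogeneous A k (∑ i ∈ s, D i) :=
  fun p a q hq => by
    rw [LinearMap.sum_apply, map_sum]
    exact Finset.sum_eq_zero fun i hi => h i hi p a q hq

theorem isHomogeneous_formalFlow {Y : ℕ → Module.End ℝ (Forms A)} (hY : ∀ n, Y n ∈ Der A 0)
    (n : ℕ) : IsHomogeneous A 0 (formalFlow Y n) := by
  induction n using Nat.strong_induction_on with
  | _ n ih =>
    cases n with
    | zero => rw [formalFlow_zero]; exact isHomogeneous_one
    | succ n =>
      rw [formalFlow]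
      refine IsHomogeneous.smul (IsHomogeneous.sum _ fun i _ => ?_) _
      rw [← add_zero (0 : ℤ)]
      exact (hY i).1.mul (ih (n - i) (by omega))

theorem smul_succ_cancel {V : Type*} [AddCommGroup V] [Module ℝ V] (n : ℕ) {a b : V}
    (h : ((n : ℝ) + 1) • a = ((n : ℝ) + 1) • b) : a = b := by
  have : ((n : ℝ) + 1) ≠ 0 := by positivity
  exact (smul_right_injective V this) h

theorem sum_antidiagonal_assoc {M : Type*} [AddCommMonoid M] (n : ℕ) (f : ℕ → ℕ → ℕ → M) :
    ∑ x ∈ Finset.HasAntidiagonal.antidiagonal n, ∑ y ∈ Finset.HasAntidiagonal.antidiagonal x.2,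
        f x.1 y.1 y.2 =
      ∑ x ∈ Finset.HasAntidiagonal.antidiagonal n, ∑ y ∈ Finset.HasAntidiagonal.antidiagonal x.1,
        f y.1 y.2 x.2 := by
  rw [Finset.sum_sigma', Finset.sum_sigma']
  refine Finset.sum_nbij' (fun z => ⟨(z.1.1 + z.2.1, z.2.2), (z.1.1, z.2.1)⟩)
    (fun z => ⟨(z.2.1, z.2.2 + z.1.2), (z.2.2, z.1.2)⟩) ?_ ?_ ?_ ?_ ?_ <;>
    rintro ⟨⟨a, b⟩, ⟨c, d⟩⟩ h <;>
    simp only [Finset.mem_sigma, Finset.HasAntidiagonal.mem_antidiagonal] at h ⊢ <;> obtain ⟨rfl, rfl⟩ := h <;>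
    simp [add_assoc]

theorem sum_antidiagonal_left_comm {M : Type*} [AddCommMonoid M] (n : ℕ) (f : ℕ → ℕ → ℕ → M) :
    ∑ x ∈ Finset.HasAntidiagonal.antidiagonal n, ∑ y ∈ Finset.HasAntidiagonal.antidiagonal x.2,
        f x.1 y.1 y.2 =
      ∑ x ∈ Finset.HasAntidiagonal.antidiagonal n, ∑ y ∈ Finset.HasAntidiagonal.antidiagonal x.2,
        f y.1 x.1 y.2 := by
  rw [Finset.sum_sigma', Finset.sum_sigma']
  refine Finset.sum_nbij' (fun z => ⟨(z.2.1, z.1.1 + z.2.2), (z.1.1, z.2.2)⟩)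
    (fun z => ⟨(z.2.1, z.1.1 + z.2.2), (z.1.1, z.2.2)⟩) ?_ ?_ ?_ ?_ ?_ <;>
    rintro ⟨⟨a, b⟩, ⟨c, d⟩⟩ h <;>
    simp only [Finset.mem_sigma, Finset.HasAntidiagonal.mem_antidiagonal] at h ⊢ <;> obtain ⟨rfl, rfl⟩ := h <;>
    simp [add_left_comm]

theorem sum_antidiagonal_right_comm {M : Type*} [AddCommMonoid M] (n : ℕ) (f : ℕ → ℕ → ℕ → M) :
    ∑ x ∈ Finset.HasAntidiagonal.antidiagonal n, ∑ y ∈ Finset.HasAntidiagonal.antidiagonal x.1,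
        f y.1 y.2 x.2 =
      ∑ x ∈ Finset.HasAntidiagonal.antidiagonal n, ∑ y ∈ Finset.HasAntidiagonal.antidiagonal x.1,
        f y.1 x.2 y.2 := by
  rw [Finset.sum_sigma', Finset.sum_sigma']
  refine Finset.sum_nbij' (fun z => ⟨(z.2.1 + z.1.2, z.2.2), (z.2.1, z.1.2)⟩)
    (fun z => ⟨(z.2.1 + z.1.2, z.2.2), (z.2.1, z.1.2)⟩) ?_ ?_ ?_ ?_ ?_ <;>
    rintro ⟨⟨a, b⟩, ⟨c, d⟩⟩ h <;>
    simp only [Finset.mem_sigma, Finset.HasAntidiagonal.mem_antidiagonal] at h ⊢ <;> obtain ⟨rfl, rfl⟩ := h <;>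
    simp [add_right_comm]

/-- The flow of a family of derivations consists of automorphisms. -/
theorem formalFlow_map_mul {Y : ℕ → Module.End ℝ (Forms A)} (hY : ∀ n, Y n ∈ Der A 0)
    (n : ℕ) (a b : Forms A) : formalFlow Y n (a * b) =
      ∑ x ∈ Finset.HasAntidiagonal.antidiagonal n, formalFlow Y x.1 a * formalFlow Y x.2 b := by
  induction n using Nat.strong_induction_on with
  | _ n ih =>
    cases n with
    | zero => simp [formalFlow_zero]
    | succ n =>
      have hs (m : ℕ) (x : Forms A) : ((m : ℝ) + 1) • formalFlow Y (m + 1) x =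
          ∑ y ∈ Finset.HasAntidiagonal.antidiagonal m, Y y.1 (formalFlow Y y.2 x) := by
        rw [← LinearMap.smul_apply, formalFlow_succ, LinearMap.sum_apply]
        rfl
      have hl : ∑ x ∈ Finset.HasAntidiagonal.antidiagonal (n + 1),
          (x.1 : ℝ) • (formalFlow Y x.1 a * formalFlow Y x.2 b) =
          ∑ x ∈ Finset.HasAntidiagonal.antidiagonal n,
            ∑ y ∈ Finset.HasAntidiagonal.antidiagonal x.1,
              Y y.1 (formalFlow Y y.2 a) * formalFlow Y x.2 b := by
        rw [Finset.Nat.sum_antidiagonal_succ]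
        simp only [Nat.cast_zero, zero_smul, zero_add, Nat.cast_add, Nat.cast_one]
        refine Finset.sum_congr rfl fun x _ => ?_
        rw [← smul_mul_assoc, hs, Finset.sum_mul]
      have hr : ∑ x ∈ Finset.HasAntidiagonal.antidiagonal (n + 1),
          (x.2 : ℝ) • (formalFlow Y x.1 a * formalFlow Y x.2 b) =
          ∑ x ∈ Finset.HasAntidiagonal.antidiagonal n,
            ∑ y ∈ Finset.HasAntidiagonal.antidiagonal x.2,
              formalFlow Y x.1 a * Y y.1 (formalFlow Y y.2 b) := by
        rw [Finset.Nat.sum_antidiagonal_succ']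
        simp only [Nat.cast_zero, zero_smul, zero_add, Nat.cast_add, Nat.cast_one]
        refine Finset.sum_congr rfl fun x _ => ?_
        rw [← mul_smul_comm, hs, Finset.mul_sum]
      refine smul_succ_cancel n ?_
      rw [hs, Finset.smul_sum]
      -- The weight `n + 1` is split as `x.1 + x.2`, the product rule for `t d/dt`. The recursion
      -- for the flow then applies to each factor separately.
      have h1 : ∑ x ∈ Finset.HasAntidiagonal.antidiagonal (n + 1),
          ((n : ℝ) + 1) • (formalFlow Y x.1 a * formalFlow Y x.2 b) =
          ∑ x ∈ Finset.HasAntidiagonal.antidiagonal (n + 1),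
            ((x.1 : ℝ) • (formalFlow Y x.1 a * formalFlow Y x.2 b) +
              (x.2 : ℝ) • (formalFlow Y x.1 a * formalFlow Y x.2 b)) := by
        refine Finset.sum_congr rfl fun x hx => ?_
        rw [← add_smul]
        congr 1
        exact_mod_cast (Finset.HasAntidiagonal.mem_antidiagonal.1 hx).symm
      rw [h1, Finset.sum_add_distrib, hl, hr,
        ← sum_antidiagonal_assoc n (fun i k l => Y i (formalFlow Y k a) * formalFlow Y l b),
        ← sum_antidiagonal_left_comm n (fun i k l => formalFlow Y k a * Y i (formalFlow Y l b)),
        ← Finset.sum_add_distrib]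
      refine Finset.sum_congr rfl fun x hx => ?_
      have hx' := Finset.HasAntidiagonal.mem_antidiagonal.1 hx
      rw [ih x.2 (by omega), map_sum, ← Finset.sum_add_distrib]
      exact Finset.sum_congr rfl fun y _ => der_zero_mul (hY _) _ _

/-- The failure, in order `n`, of the flow of `Y` to conjugate the formal family `q` to `Q`. -/
def defect (Q : Module.End ℝ (Forms A)) (q Y : ℕ → Module.End ℝ (Forms A)) (n : ℕ) :
    Module.End ℝ (Forms A) :=
  ∑ x ∈ Finset.HasAntidiagonal.antidiagonal n, formalFlow Y x.1 * q x.2 - Q * formalFlow Y n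

theorem defect_congr (Q : Module.End ℝ (Forms A)) (q : ℕ → Module.End ℝ (Forms A))
    {Y Z : ℕ → Module.End ℝ (Forms A)} {n : ℕ} (h : ∀ i < n, Y i = Z i) :
    defect Q q Y n = defect Q q Z n := by
  rw [defect, defect, formalFlow_congr h]
  congr 1
  refine Finset.sum_congr rfl fun x hx => ?_
  have hx' := Finset.HasAntidiagonal.mem_antidiagonal.1 hx
  rw [formalFlow_congr fun i hi => h i (by omega)]

theorem bar_of_isHomogeneous_zero {D : Module.End ℝ (Forms A)} (hD : IsHomogeneous A 0 D)
    (x : Forms A) : D (bar x) = bar (D x) := by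
  induction x using Forms.induction with
  | h0 => simp
  | hadd x y hx hy => simp only [map_add, hx, hy]
  | hof p a => rw [bar_ofForm, map_smul, hD.eq_ofForm a (q := p) (by simp), bar_ofForm]

/-- With `F = φ q - Q φ`, these are the coefficients of `F(ab) = F(a) φ(b) + bar(φ(a)) F(b)`: `φ` is
multiplicative and preserves degree, and `q` and `Q` are odd derivations. -/
theorem defect_apply_mul {Q : Module.End ℝ (Forms A)} {q Y : ℕ → Module.End ℝ (Forms A)}
    (hQ : Q ∈ Der A 1) (hq : ∀ n, q n ∈ Der A 1) (hY : ∀ n, Y n ∈ Der A 0) (n : ℕ)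
    (a b : Forms A) : defect Q q Y n (a * b) =
      ∑ x ∈ Finset.HasAntidiagonal.antidiagonal n, defect Q q Y x.1 a * formalFlow Y x.2 b +
      ∑ x ∈ Finset.HasAntidiagonal.antidiagonal n,
        bar (formalFlow Y x.1 a) * defect Q q Y x.2 b := by
  simp only [defect, LinearMap.sub_apply, LinearMap.sum_apply, Module.End.mul_apply, sub_mul, mul_sub,
    Finset.sum_sub_distrib, Finset.sum_mul, Finset.mul_sum]
  rw [← sum_antidiagonal_right_comm n
      (fun k l j => formalFlow Y k (q j a) * formalFlow Y l b),
    sum_antidiagonal_assoc n (fun k l j => bar (formalFlow Y k a) * formalFlow Y l (q j b))]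
  have h1 : ∑ x ∈ Finset.HasAntidiagonal.antidiagonal n, formalFlow Y x.1 (q x.2 (a * b)) =
      ∑ x ∈ Finset.HasAntidiagonal.antidiagonal n,
        ∑ y ∈ Finset.HasAntidiagonal.antidiagonal x.1,
          formalFlow Y y.1 (q x.2 a) * formalFlow Y y.2 b +
      ∑ x ∈ Finset.HasAntidiagonal.antidiagonal n,
        ∑ y ∈ Finset.HasAntidiagonal.antidiagonal x.1,
          bar (formalFlow Y y.1 a) * formalFlow Y y.2 (q x.2 b) := by
    rw [← Finset.sum_add_distrib]
    refine Finset.sum_congr rfl fun x _ => ?_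
    rw [der_one_mul (hq _), map_add, formalFlow_map_mul hY, formalFlow_map_mul hY]
    simp only [bar_of_isHomogeneous_zero (isHomogeneous_formalFlow hY _)]
  rw [h1, formalFlow_map_mul hY, map_sum]
  simp only [der_one_mul hQ, Finset.sum_add_distrib]
  abel

/-- When lower orders vanish, only the terms pairing the defect of order `n` with `φ_0 = 1` remain,
and the twisted Leibniz rule becomes the ordinary one. -/
theorem defect_mem_der {Q : Module.End ℝ (Forms A)} {q Y : ℕ → Module.End ℝ (Forms A)}
    (hQ : Q ∈ Der A 1) (hq : ∀ n, q n ∈ Der A 1) (hY : ∀ n, Y n ∈ Der A 0) {n : ℕ}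
    (h : ∀ m < n, defect Q q Y m = 0) : defect Q q Y n ∈ Der A 1 := by
  have hhom : IsHomogeneous A 1 (defect Q q Y n) := by
    refine IsHomogeneous.sub (IsHomogeneous.sum _ fun x _ => ?_) ?_
    · simpa using (isHomogeneous_formalFlow hY x.1).mul (hq x.2).1
    · simpa using hQ.1.mul (isHomogeneous_formalFlow hY n)
  refine ⟨hhom, fun p a b => ?_⟩
  rw [defect_apply_mul hQ hq hY, Finset.sum_eq_single_of_mem (n, 0) (by simp),
    Finset.sum_eq_single_of_mem (0, n) (by simp), formalFlow_zero]
  · rw [one_mul]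
    simp only [Module.End.one_apply]
    rw [bar_ofForm_eq_negOnePow]
    rcases Int.units_eq_one_or (p : ℤ).negOnePow with e | e <;> simp [e]
  · intro x hx hne
    have hx' := Finset.HasAntidiagonal.mem_antidiagonal.1 hx
    rw [h x.2, LinearMap.zero_apply, mul_zero]
    by_contra hlt
    exact hne (Prod.ext (by simp only; omega) (by simp only; omega))
  · intro x hx hne
    have hx' := Finset.HasAntidiagonal.mem_antidiagonal.1 hx
    rw [h x.1, LinearMap.zero_apply, zero_mul]
    by_contra hlt
    exact hne (Prod.ext (by simp only; omega) (by simp only; omega))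

/-- The series `F = φ q - Q φ` satisfies `Q F + F q = 0`, since `Q² = 0` and `q² = 0`. Its lowest
coefficient therefore anticommutes with `Q = q 0`. -/
theorem defect_anticomm {Q : Module.End ℝ (Forms A)} {q Y : ℕ → Module.End ℝ (Forms A)}
    (hQ : Q * Q = 0) (hq : IsFormalDeformation A Q q) {n : ℕ}
    (h : ∀ m < n, defect Q q Y m = 0) :
    Q * defect Q q Y n + defect Q q Y n * Q = 0 := by
  let φ := PowerSeries.mk (formalFlow Y)
  let q' := PowerSeries.mk q
  let F := φ * q' - PowerSeries.C Q * φ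
  have hF (m : ℕ) : PowerSeries.coeff m F = defect Q q Y m := by
    rw [map_sub, PowerSeries.coeff_C_mul, PowerSeries.coeff_mul]
    simp [φ, q', defect]
  have hq2 : q' * q' = 0 := by
    ext1 m
    simpa [q', PowerSeries.coeff_mul] using hq.sq_zero m
  have hQ2 : (PowerSeries.C Q : PowerSeries (Module.End ℝ (Forms A))) * PowerSeries.C Q = 0 := by
    rw [← map_mul, hQ, map_zero]
  have h1 : PowerSeries.C Q * F + F * q' = 0 := by
    simp only [F, mul_sub, sub_mul, mul_assoc, hq2]
    rw [← mul_assoc (PowerSeries.C Q) (PowerSeries.C Q), hQ2]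
    simp
  have h2 := congrArg (PowerSeries.coeff n) h1
  rw [map_add, PowerSeries.coeff_C_mul, hF, PowerSeries.coeff_mul,
    Finset.sum_eq_single_of_mem (n, 0) (by simp), hF, PowerSeries.coeff_mk, hq.zero] at h2
  · simpa using h2
  · intro x hx hne
    have hx' := Finset.HasAntidiagonal.mem_antidiagonal.1 hx
    rw [hF, h x.1, zero_mul]
    by_contra hlt
    exact hne (Prod.ext (by simp only; omega) (by simp only; omega))

theorem formalFlow_update (Y : ℕ → Module.End ℝ (Forms A)) (n : ℕ) (Z : Module.End ℝ (Forms A)) :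
    formalFlow (Function.update Y n Z) (n + 1) =
      formalFlow (Function.update Y n 0) (n + 1) + ((n : ℝ) + 1)⁻¹ • Z := by
  rw [formalFlow, formalFlow, ← smul_add]
  congr 1
  rw [Fin.sum_univ_castSucc, Fin.sum_univ_castSucc]
  have (i : Fin n) (W : Module.End ℝ (Forms A)) :
      formalFlow (Function.update Y n W) (n - i) = formalFlow Y (n - i) :=
    formalFlow_congr fun j hj => Function.update_of_ne (by omega) _ _
  simp [this, formalFlow_zero, (Fin.is_lt _).ne]

/-- Up to order `n + 1`, the coefficient `Y n` enters only through `φ_(n+1)`, where it is multiplied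
by `φ_0 = 1` and by `1/(n+1)`. -/
theorem defect_update {Q : Module.End ℝ (Forms A)} {q : ℕ → Module.End ℝ (Forms A)}
    (hq : q 0 = Q) (Y : ℕ → Module.End ℝ (Forms A)) (n : ℕ) (Z : Module.End ℝ (Forms A)) :
    defect Q q (Function.update Y n Z) (n + 1) =
      defect Q q (Function.update Y n 0) (n + 1) + ((n : ℝ) + 1)⁻¹ • (Z * Q - Q * Z) := by
  rw [defect, defect, Finset.Nat.sum_antidiagonal_succ', Finset.Nat.sum_antidiagonal_succ',
    formalFlow_update Y n Z, hq]
  have h : ∑ x ∈ Finset.HasAntidiagonal.antidiagonal n,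
      formalFlow (Function.update Y n Z) x.1 * q (x.2 + 1) =
      ∑ x ∈ Finset.HasAntidiagonal.antidiagonal n,
        formalFlow (Function.update Y n 0) x.1 * q (x.2 + 1) := by
    refine Finset.sum_congr rfl fun x hx => ?_
    have hx' := Finset.HasAntidiagonal.mem_antidiagonal.1 hx
    rw [formalFlow_congr fun j hj => ?_]
    rw [Function.update_of_ne (by omega), Function.update_of_ne (by omega)]
  rw [h]
  simp only [add_mul, mul_add, smul_mul_assoc, mul_smul_comm, smul_sub]
  abel

/-- If the deformation complex is acyclic, then the structure is rigid. -/
theorem isRigid_of_acyclic {Q : Module.End ℝ (Forms A)} (hQ : IsLieAlgebroid A Q)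
    (h : IsAcyclicDeformationComplex A Q) : IsRigid A Q := by
  have hinf : ∀ D ∈ Der A 1, Q * D + D * Q = 0 → ∃ X ∈ Der A 0, D = Q * X - X * Q := by
    intro D hD h1
    obtain ⟨E, hE, h2⟩ := h 1 D hD (by
      rw [gradedComm, Int.negOnePow_one, Units.neg_smul, one_smul, sub_neg_eq_add, h1])
    refine ⟨E, by simpa using hE, ?_⟩
    rw [← h2, gradedComm, sub_self, Int.negOnePow_zero, one_smul]
  refine ⟨hinf, fun q hq => ?_⟩
  -- The hypotheses stand inside the existential statement so that `choose` yields a total function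
  -- `Z`, usable in the recursion below.
  have step (n : ℕ) (Y : ℕ → Module.End ℝ (Forms A)) : ∃ Z : Module.End ℝ (Forms A),
      (∀ i, Y i ∈ Der A 0) → (∀ m ≤ n, defect Q q Y m = 0) →
        Z ∈ Der A 0 ∧ defect Q q (Function.update Y n Z) (n + 1) = 0 := by
    by_cases hY : (∀ i, Y i ∈ Der A 0) ∧ ∀ m ≤ n, defect Q q Y m = 0
    · have hY' : ∀ i, Function.update Y n 0 i ∈ Der A 0 := fun i => by
        by_cases hi : i = n
        · subst hi; simp
        · rw [Function.update_of_ne hi]; exact hY.1 i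
      have h0 : ∀ m < n + 1, defect Q q (Function.update Y n 0) m = 0 := fun m hm => by
        rw [← hY.2 m (by omega)]
        exact defect_congr Q q fun i hi => Function.update_of_ne (by omega) _ _
      obtain ⟨X, hX, h1⟩ := hinf _ (defect_mem_der hQ.mem_der hq.mem_der hY' h0)
        (defect_anticomm hQ.sq_zero hq h0)
      -- The factor `n + 1` offsets the denominator in `defect_update`, so the change is exactly
      -- `-[Q, X]`.
      refine ⟨((n : ℝ) + 1) • X, fun _ _ => ⟨Submodule.smul_mem _ _ hX, ?_⟩⟩
      have hn : ((n : ℝ) + 1) ≠ 0 := by positivity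
      rw [defect_update hq.zero, h1, smul_mul_assoc, mul_smul_comm, ← smul_sub, smul_smul,
        inv_mul_cancel₀ hn, one_smul]
      abel
    · exact ⟨0, fun h1 h2 => absurd ⟨h1, h2⟩ hY⟩
  choose Z hZ using step
  -- Step `n` changes only the entry `n`, so every entry is eventually constant; the diagonal `S (n
  -- + 1) n` is the family whose flow is used.
  let S : ℕ → ℕ → Module.End ℝ (Forms A) :=
    Nat.rec (fun _ => 0) fun n Y => Function.update Y n (Z n Y)
  have hS (n : ℕ) : S (n + 1) = Function.update (S n) n (Z n (S n)) := rfl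
  have hgood (n : ℕ) : (∀ i, S n i ∈ Der A 0) ∧ ∀ m ≤ n, defect Q q (S n) m = 0 := by
    induction n with
    | zero =>
      refine ⟨fun i => Submodule.zero_mem _, fun m hm => ?_⟩
      obtain rfl : m = 0 := by omega
      simp [defect, formalFlow_zero, hq.zero]
    | succ n ih =>
      obtain ⟨h1, h2⟩ := hZ n (S n) ih.1 ih.2
      rw [hS]
      refine ⟨fun i => ?_, fun m hm => ?_⟩
      · by_cases hi : i = n
        · subst hi; simpa using h1
        · rw [Function.update_of_ne hi]; exact ih.1 i
      · rcases Nat.lt_or_ge n m with hm' | hm'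
        · obtain rfl : m = n + 1 := by omega
          exact h2
        · rw [← ih.2 m hm']
          exact defect_congr Q q fun i hi => Function.update_of_ne (by omega) _ _
  have hstable (i n : ℕ) (hin : i < n) : S n i = S (i + 1) i := by
    induction n with
    | zero => omega
    | succ n ih =>
      rcases Nat.lt_or_ge i n with h1 | h1
      · rw [hS, Function.update_of_ne (by omega), ih h1]
      · obtain rfl : i = n := by omega
        rfl
  refine ⟨formalFlow fun n => S (n + 1) n,
    ⟨formalFlow_zero _, isHomogeneous_formalFlow fun n => (hgood (n + 1)).1 n,
      formalFlow_map_mul fun n => (hgood (n + 1)).1 n⟩, fun n => ?_⟩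
  have h1 := (hgood n).2 n le_rfl
  rw [defect_congr Q q fun i hi => hstable i n hi] at h1
  exact sub_eq_zero.1 h1

end Rigidity

/-! ### Hadamard's lemma in Euclidean space. -/

section Hadamard

open MeasureTheory Set

open scoped ContDiff Convolution

/-- The integral is the convolution, evaluated at `0`, of the indicator of `(0, 1]` with `s ↦ β(s)
k(y, -s)`. The bump `β` is `1` on `[-1, 1]`, so it changes nothing there, but supplies the compact
support required for smoothness in the parameter. -/
theorem contDiff_integral_unitInterval {E : Type*} [NormedAddCommGroup E] [NormedSpace ℝ E]
    {k : E → ℝ → ℝ} (hk : ContDiff ℝ ∞ (Function.uncurry k)) :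
    ContDiff ℝ ∞ fun y => ∫ t in (0 : ℝ)..1, k y t := by
  let β : ContDiffBump (0 : ℝ) := ⟨1, 2, by norm_num, by norm_num⟩
  let g : E → ℝ → ℝ := fun y s => β s * k y (-s)
  have hg : ContDiff ℝ ∞ (Function.uncurry g) :=
    (β.contDiff.comp contDiff_snd).mul (hk.comp (contDiff_fst.prodMk contDiff_snd.neg))
  have h := contDiffOn_convolution_right_with_param_comp (μ := volume)
    (ContinuousLinearMap.mul ℝ ℝ) (contDiffOn_const (c := (0 : ℝ))) (n := (⊤ : ℕ∞)) (s := univ)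
    (f := indicator (Ioc 0 1) fun _ => (1 : ℝ)) (g := g) (k := Metric.closedBall 0 2) isOpen_univ
    (isCompact_closedBall _ _)
    (fun p x _ hx => by
      have : β x = 0 := β.zero_of_le_dist (by simpa using (not_le.1 (by simpa using hx)).le)
      simp [g, this])
    ((locallyIntegrable_const 1).indicator measurableSet_Ioc) hg.contDiffOn
  rw [contDiffOn_univ] at h
  refine (congrArg (ContDiff ℝ ∞) (funext fun y => ?_)).mpr h
  rw [intervalIntegral.integral_of_le zero_le_one, convolution_def,
    ← integral_indicator measurableSet_Ioc]
  congr 1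
  funext t
  by_cases ht : t ∈ Ioc (0 : ℝ) 1
  · have : β (-t) = 1 := β.one_of_mem_closedBall (by
      simp only [Metric.mem_closedBall, dist_zero_right, norm_neg, Real.norm_eq_abs]
      rw [abs_of_pos ht.1]
      exact ht.2)
    simp [ht, g, this]
  · simp [ht]

/-- Hadamard's lemma. -/
theorem exists_hadamard {n : ℕ} {u : EuclideanSpace ℝ (Fin n) → ℝ} (hu : ContDiff ℝ ∞ u)
    (y₀ : EuclideanSpace ℝ (Fin n)) :
    ∃ h : Fin n → EuclideanSpace ℝ (Fin n) → ℝ, (∀ j, ContDiff ℝ ∞ (h j)) ∧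
      (∀ y, u y = u y₀ + ∑ j, (y j - y₀ j) * h j y) ∧
      ∀ j, h j y₀ = fderiv ℝ u y₀ (EuclideanSpace.single j 1) := by
  have hu' : ContDiff ℝ ∞ (fderiv ℝ u) := hu.fderiv_right (by norm_cast)
  have hk (j : Fin n) : ContDiff ℝ ∞ (Function.uncurry fun (y : EuclideanSpace ℝ (Fin n)) (t : ℝ) =>
      fderiv ℝ u (y₀ + t • (y - y₀)) (EuclideanSpace.single j 1)) := by
    refine (hu'.comp ?_).clm_apply contDiff_const
    fun_prop
  -- The coefficients come from integrating the derivative of `u` along the segment from `y₀` to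
  -- `y`.
  refine ⟨fun j y => ∫ t in (0 : ℝ)..1,
    fderiv ℝ u (y₀ + t • (y - y₀)) (EuclideanSpace.single j 1),
    fun j => contDiff_integral_unitInterval (hk j), fun y => ?_, fun j => by simp⟩
  have hd (t : ℝ) : HasDerivAt (fun t : ℝ => u (y₀ + t • (y - y₀)))
      (fderiv ℝ u (y₀ + t • (y - y₀)) (y - y₀)) t := by
    have h1 : HasDerivAt (fun t : ℝ => y₀ + t • (y - y₀)) (y - y₀) t := by
      simpa using ((hasDerivAt_id t).smul_const (y - y₀)).const_add y₀
    exact ((hu.differentiable (by simp)).differentiableAt.hasFDerivAt).comp_hasDerivAt t h1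
  have hc (w : EuclideanSpace ℝ (Fin n)) :
      Continuous fun t : ℝ => fderiv ℝ u (y₀ + t • (y - y₀)) w :=
    (hu'.continuous.comp (by fun_prop)).clm_apply continuous_const
  have h2 := intervalIntegral.integral_eq_sub_of_hasDerivAt (a := 0) (b := 1)
    (fun t _ => hd t) ((hc _).intervalIntegrable _ _)
  have hsum : y - y₀ = ∑ j, (y j - y₀ j) • EuclideanSpace.single j (1 : ℝ) := by
    ext i
    simp [Pi.single_apply]
  have h3 (t : ℝ) : fderiv ℝ u (y₀ + t • (y - y₀)) (y - y₀) =
      ∑ j, (y j - y₀ j) * fderiv ℝ u (y₀ + t • (y - y₀)) (EuclideanSpace.single j 1) := by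
    conv_lhs => rw [hsum]
    rw [map_sum]
    rw [← hsum]
    simp
  simp only [h3] at h2
  rw [intervalIntegral.integral_finsetSum
    fun j _ => ((hc _).const_mul _).intervalIntegrable _ _] at h2
  simp only [intervalIntegral.integral_const_mul, one_smul, zero_smul, add_zero,
    add_sub_cancel] at h2
  rw [h2]
  ring

end Hadamard

/-! ### Derivations of the algebra of smooth functions, in charts. -/

section Manifold

open scoped ContDiff

open Filter Set

variable {n : ℕ} {M : Type*} [TopologicalSpace M] [ChartedSpace (EuclideanSpace ℝ (Fin n)) M]

theorem isOpen_target (c : M) : IsOpen (extChartAt (𝓡 n) c).target :=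
  isOpen_extChartAt_target c

theorem bump_eq_zero_of_notMem {c x : M} (b : SmoothBumpFunction (𝓡 n) c)
    (hx : x ∉ (extChartAt (𝓡 n) c).source) : b x = 0 := by
  by_contra h
  exact hx (by simpa using b.support_subset_source h)

/-- The open set where the bump function is known to be `1`. -/
def bumpOne {c : M} (b : SmoothBumpFunction (𝓡 n) c) : Set M :=
  (extChartAt (𝓡 n) c).source ∩ extChartAt (𝓡 n) c ⁻¹' Metric.ball (extChartAt (𝓡 n) c c) b.rIn

theorem isOpen_bumpOne {c : M} (b : SmoothBumpFunction (𝓡 n) c) : IsOpen (bumpOne b) :=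
  (continuousOn_extChartAt c).isOpen_inter_preimage (isOpen_extChartAt_source c) Metric.isOpen_ball

theorem mem_bumpOne {c : M} (b : SmoothBumpFunction (𝓡 n) c) : c ∈ bumpOne b :=
  ⟨mem_extChartAt_source c, Metric.mem_ball_self b.rIn_pos⟩

theorem eq_one_of_mem_bumpOne {c x : M} {b : SmoothBumpFunction (𝓡 n) c} (hx : x ∈ bumpOne b) :
    b x = 1 :=
  b.one_of_dist_le (by simpa using hx.1) hx.2.le

variable [IsManifold (𝓡 n) ((⊤ : ℕ∞) : WithTop ℕ∞) M]

theorem contDiffOn_comp_symm (g : SmoothFun n M) (c : M) :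
    ContDiffOn ℝ ∞ (g ∘ (extChartAt (𝓡 n) c).symm) (extChartAt (𝓡 n) c).target :=
  (g.contMDiff.comp_contMDiffOn (contMDiffOn_extChartAt_symm c)).contDiffOn

theorem differentiableAt_comp_symm (g : SmoothFun n M) {c x : M}
    (hx : x ∈ (extChartAt (𝓡 n) c).source) :
    DifferentiableAt ℝ (g ∘ (extChartAt (𝓡 n) c).symm) (extChartAt (𝓡 n) c x) :=
  ((contDiffOn_comp_symm g c).differentiableOn (by simp)).differentiableAt
    ((isOpen_target c).mem_nhds ((extChartAt (𝓡 n) c).map_source hx))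

/-- The chart expression of `g` times the Euclidean bump is smooth everywhere, because the closed
support of the bump meets no point outside the target. Hadamard's lemma needs such a globally smooth
function. -/
theorem exists_contDiff_extension {c : M} (b : SmoothBumpFunction (𝓡 n) c) (g : SmoothFun n M) :
    ∃ u : EuclideanSpace ℝ (Fin n) → ℝ, ContDiff ℝ ∞ u ∧
      ∀ y ∈ Metric.ball (extChartAt (𝓡 n) c c) b.rIn, u y = g ((extChartAt (𝓡 n) c).symm y) := by
  refine ⟨fun y => b.toContDiffBump y • (g ∘ (extChartAt (𝓡 n) c).symm) y, ?_, fun y hy => ?_⟩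
  · refine contDiff_iff_contDiffAt.2 fun y => ?_
    by_cases hy : y ∈ tsupport b.toContDiffBump
    · have hy' : y ∈ (extChartAt (𝓡 n) c).target := by
        rw [ContDiffBump.tsupport_eq] at hy
        exact b.closedBall_subset ⟨hy, by simp⟩
      exact b.toContDiffBump.contDiffAt.smul
        ((contDiffOn_comp_symm g c).contDiffAt ((isOpen_target c).mem_nhds hy'))
    · refine (contDiffAt_const (c := (0 : ℝ))).congr_of_eventuallyEq ?_
      filter_upwards [(isClosed_tsupport _).isOpen_compl.mem_nhds hy] with z hz
      have : b.toContDiffBump z = 0 := image_eq_zero_of_notMem_tsupport hz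
      change b.toContDiffBump z • (g ∘ (extChartAt (𝓡 n) c).symm) z = 0
      rw [this, zero_smul]
  · change b.toContDiffBump y • (g ∘ (extChartAt (𝓡 n) c).symm) y = _
    rw [b.toContDiffBump.one_of_mem_closedBall (Metric.ball_subset_closedBall hy), one_smul]
    rfl

variable [T2Space M]

/-- A smooth bump function, as an element of the algebra of smooth functions. -/
def bumpFun {c : M} (b : SmoothBumpFunction (𝓡 n) c) : SmoothFun n M := ⟨b, b.contMDiff⟩

/-- Derivations of the algebra of smooth functions are local. -/
theorem derivation_apply_eq_of_eventuallyEq (X : VField (SmoothFun n M)) {f g : SmoothFun n M}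
    {x : M} (h : ∀ᶠ y in nhds x, f y = g y) : X f x = X g x := by
  obtain ⟨b, hb, -⟩ := (SmoothBumpFunction.nhds_basis_support (I := 𝓡 n) h).mem_iff.1 h
  -- Applying `X` to this product and evaluating at `x`, where the bump is `1` and `f - g` is `0`,
  -- leaves only `X (f - g) x`.
  have h0 : bumpFun b * (f - g) = 0 := by
    ext y
    by_cases hy : b y = 0
    · change b y * (f - g) y = 0
      rw [hy, zero_mul]
    · have h1 : f y = g y := hb (subset_tsupport _ hy)
      simp [h1]
  have h1 := congrArg (fun k : SmoothFun n M => k x) (congrArg X h0)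
  have hbx : (bumpFun b : SmoothFun n M) x = 1 := b.eq_one
  have hfg : (f - g) x = 0 := sub_eq_zero.2 h.self_of_nhds
  have h2 : (bumpFun b * X (f - g) + (f - g) * X (bumpFun b)) x = 0 := by
    rw [Derivation.leibniz, map_zero] at h1
    exact h1
  have h3 : (X f - X g) x = 0 := by
    rw [← map_sub]
    have : (bumpFun b * X (f - g) + (f - g) * X (bumpFun b)) x =
      bumpFun b x * X (f - g) x + (f - g) x * X (bumpFun b) x := rfl
    rw [this, hbx, hfg] at h2
    linarith
  exact sub_eq_zero.1 h3

/-- The product of a bump function with a coordinate function of the chart. -/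
def chartCoord {c : M} (b : SmoothBumpFunction (𝓡 n) c) (j : Fin n) : SmoothFun n M :=
  ⟨fun x => b x • (extChartAt (𝓡 n) c x) j, b.contMDiff_smul (by
    have h1 := contMDiffOn_extChartAt (I := 𝓡 n) (n := ∞) (x := c)
    have h2 : ContDiff ℝ ∞ fun y : EuclideanSpace ℝ (Fin n) => y j := by fun_prop
    exact h2.contMDiff.comp_contMDiffOn h1)⟩

/-- A smooth function on the vector space, pulled back along a chart and multiplied with a bump
function. -/
def chartPullback {c : M} (b : SmoothBumpFunction (𝓡 n) c) {h : EuclideanSpace ℝ (Fin n) → ℝ}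
    (hh : ContDiff ℝ ∞ h) : SmoothFun n M :=
  ⟨fun x => b x • h (extChartAt (𝓡 n) c x), b.contMDiff_smul
    (hh.contMDiff.comp_contMDiffOn contMDiffOn_extChartAt)⟩

/-- The product of a bump function with the derivative of a function in a direction of the chart. -/
def chartDeriv {c : M} (b : SmoothBumpFunction (𝓡 n) c) (w : EuclideanSpace ℝ (Fin n))
    (g : SmoothFun n M) : SmoothFun n M :=
  ⟨fun x => b x • fderiv ℝ (g ∘ (extChartAt (𝓡 n) c).symm) (extChartAt (𝓡 n) c x) w,
    b.contMDiff_smul (by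
      have h1 := contMDiffOn_extChartAt (I := 𝓡 n) (n := ∞) (x := c)
      have h2 := ((contDiffOn_comp_symm g c).fderiv_of_isOpen (m := ∞) (isOpen_target c)
        (by norm_cast)).clm_apply (contDiffOn_const (c := w))
      refine h2.contMDiffOn.comp h1 fun x hx => ?_
      exact (extChartAt (𝓡 n) c).map_source (by simpa using hx))⟩

theorem chartDeriv_apply {c : M} (b : SmoothBumpFunction (𝓡 n) c) (w : EuclideanSpace ℝ (Fin n))
    (g : SmoothFun n M) (x : M) : chartDeriv b w g x =
      b x * fderiv ℝ (g ∘ (extChartAt (𝓡 n) c).symm) (extChartAt (𝓡 n) c x) w := rfl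

/-- The product of a bump function with a constant vector field of the chart. -/
def chartField {c : M} (b : SmoothBumpFunction (𝓡 n) c) (w : EuclideanSpace ℝ (Fin n)) :
    VField (SmoothFun n M) :=
  Derivation.mk'
    { toFun := chartDeriv b w
      map_add' := fun f g => by
        ext x
        by_cases hx : x ∈ (extChartAt (𝓡 n) c).source
        · change chartDeriv b w (f + g) x = chartDeriv b w f x + chartDeriv b w g x
          have h := fderiv_add (differentiableAt_comp_symm f hx) (differentiableAt_comp_symm g hx)
          have h' : ((f + g : SmoothFun n M) ∘ (extChartAt (𝓡 n) c).symm) =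
            f ∘ (extChartAt (𝓡 n) c).symm + g ∘ (extChartAt (𝓡 n) c).symm := rfl
          simp only [chartDeriv_apply]
          rw [h', h, add_apply, mul_add]
        · change chartDeriv b w (f + g) x = chartDeriv b w f x + chartDeriv b w g x
          simp [chartDeriv_apply, bump_eq_zero_of_notMem b hx]
      map_smul' := fun r f => by
        ext x
        by_cases hx : x ∈ (extChartAt (𝓡 n) c).source
        · change chartDeriv b w (r • f) x = r * chartDeriv b w f x
          have h := fderiv_const_smul (differentiableAt_comp_symm f hx) r
          have h' : ((r • f : SmoothFun n M) ∘ (extChartAt (𝓡 n) c).symm) =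
            r • (f ∘ (extChartAt (𝓡 n) c).symm) := rfl
          simp only [chartDeriv_apply]
          rw [h', h, smul_apply, smul_eq_mul, mul_left_comm]
        · change chartDeriv b w (r • f) x = r * chartDeriv b w f x
          simp [chartDeriv_apply, bump_eq_zero_of_notMem b hx] }
    (fun f g => by
      ext x
      change chartDeriv b w (f * g) x = f x * chartDeriv b w g x + g x * chartDeriv b w f x
      by_cases hx : x ∈ (extChartAt (𝓡 n) c).source
      · have h := fderiv_mul (differentiableAt_comp_symm f hx) (differentiableAt_comp_symm g hx)
        have h' : ((f * g : SmoothFun n M) ∘ (extChartAt (𝓡 n) c).symm) =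
          f ∘ (extChartAt (𝓡 n) c).symm * g ∘ (extChartAt (𝓡 n) c).symm := rfl
        simp only [chartDeriv_apply]
        rw [h', h]
        simp only [add_apply, smul_apply, smul_eq_mul, Function.comp_apply,
          (extChartAt (𝓡 n) c).left_inv hx]
        ring
      · simp [chartDeriv_apply, bump_eq_zero_of_notMem b hx])

theorem chartField_apply {c : M} (b : SmoothBumpFunction (𝓡 n) c) (w : EuclideanSpace ℝ (Fin n))
    (g : SmoothFun n M) (x : M) : chartField b w g x =
      b x * fderiv ℝ (g ∘ (extChartAt (𝓡 n) c).symm) (extChartAt (𝓡 n) c x) w := rfl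

/-- A derivation, in a chart. -/
theorem derivation_apply_eq_sum (X : VField (SmoothFun n M)) (g : SmoothFun n M) {c x : M}
    {b : SmoothBumpFunction (𝓡 n) c} (hx : x ∈ bumpOne b) :
    X g x = ∑ j, X (chartCoord b j) x * chartField b (EuclideanSpace.single j 1) g x := by
  obtain ⟨u, hu, hug⟩ := exists_contDiff_extension b g
  obtain ⟨h, hh, hexp, hval⟩ := exists_hadamard hu (extChartAt (𝓡 n) c x)
  -- The Hadamard expansion at `x`, made global by the bump, which is `1` near `x`. Since `X` kills
  -- constants and the factors `x_j - x_j(x)` vanish at `x`, only `h_j(x) X(x_j)` survives, and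
  -- `h_j(x)` is the partial derivative.
  let G : SmoothFun n M := algebraMap ℝ _ (u (extChartAt (𝓡 n) c x)) +
    ∑ j, (chartCoord b j - algebraMap ℝ _ (extChartAt (𝓡 n) c x j)) * chartPullback b (hh j)
  have sum_apply (F : Fin n → SmoothFun n M) (y : M) : (∑ j, F j) y = ∑ j, F j y :=
    map_sum (ContMDiffMap.evalRingHom y) F Finset.univ
  have hG : ∀ᶠ y in nhds x, g y = G y := by
    filter_upwards [(isOpen_bumpOne b).mem_nhds hx] with y hy
    have h1 : g y = u (extChartAt (𝓡 n) c y) := by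
      rw [hug _ hy.2, (extChartAt (𝓡 n) c).left_inv hy.1]
    have h2 (j : Fin n) : ((chartCoord b j - algebraMap ℝ _ (extChartAt (𝓡 n) c x j)) *
        chartPullback b (hh j)) y = (b y • extChartAt (𝓡 n) c y j - extChartAt (𝓡 n) c x j) *
          (b y • h j (extChartAt (𝓡 n) c y)) := rfl
    have h3 : G y = u (extChartAt (𝓡 n) c x) + (∑ j, (chartCoord b j - algebraMap ℝ _
      (extChartAt (𝓡 n) c x j)) * chartPullback b (hh j)) y := rfl
    rw [h3, sum_apply, h1, hexp]
    simp only [h2, eq_one_of_mem_bumpOne hy, one_smul]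
  rw [derivation_apply_eq_of_eventuallyEq X hG, map_add, Derivation.map_algebraMap, zero_add, map_sum,
    sum_apply]
  refine Finset.sum_congr rfl fun j _ => ?_
  rw [Derivation.leibniz, map_sub, Derivation.map_algebraMap, sub_zero]
  have h4 : ((chartCoord b j - algebraMap ℝ (SmoothFun n M) (extChartAt (𝓡 n) c x j)) •
      X (chartPullback b (hh j)) + chartPullback b (hh j) • X (chartCoord b j)) x =
      (b x • extChartAt (𝓡 n) c x j - extChartAt (𝓡 n) c x j) * X (chartPullback b (hh j)) x +
        (b x • h j (extChartAt (𝓡 n) c x)) * X (chartCoord b j) x := rfl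
  have h5 : fderiv ℝ (g ∘ (extChartAt (𝓡 n) c).symm) (extChartAt (𝓡 n) c x) =
      fderiv ℝ u (extChartAt (𝓡 n) c x) := by
    refine Filter.EventuallyEq.fderiv_eq ?_
    filter_upwards [Metric.isOpen_ball.mem_nhds hx.2] with y hy
    exact (hug y hy).symm
  rw [h4, chartField_apply, h5, hval, eq_one_of_mem_bumpOne hx]
  simp [mul_comm]

end Manifold

/-! ### The local frame of a manifold, from a partition of unity. -/

section Frame

open scoped ContDiff

open Filter Set

universe u

variable {n : ℕ} {M : Type u} [TopologicalSpace M] [ChartedSpace (EuclideanSpace ℝ (Fin n)) M]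

theorem SmoothFun.sum_apply {ι : Type*} (s : Finset ι) (F : ι → SmoothFun n M) (y : M) :
    (∑ j ∈ s, F j) y = ∑ j ∈ s, F j y :=
  map_sum (ContMDiffMap.evalRingHom y) F s

/-- Glueing smooth functions by means of a partition of unity. -/
def partitionGlue {ι : Type*} (ρ : SmoothPartitionOfUnity ι (𝓡 n) M univ) :
    (ι → SmoothFun n M) →ₗ[SmoothFun n M] SmoothFun n M where
  toFun g := ⟨fun x => ∑ᶠ i, ρ i x • g i x,
    ρ.contMDiff_finsum_smul fun i _ _ => (g i).contMDiff.contMDiffAt⟩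
  map_add' g h := by
    ext x
    change ∑ᶠ i, ρ i x • (g i + h i) x = (∑ᶠ i, ρ i x • g i x) + ∑ᶠ i, ρ i x • h i x
    rw [← ρ.sum_finsupport_smul_eq_finsum x (fun i => g i),
      ← ρ.sum_finsupport_smul_eq_finsum x (fun i => h i),
      ← ρ.sum_finsupport_smul_eq_finsum x (fun i => (g i + h i : SmoothFun n M)),
      ← Finset.sum_add_distrib]
    exact Finset.sum_congr rfl fun i _ => smul_add (ρ i x) (g i x) (h i x)
  map_smul' f g := by
    ext x
    change ∑ᶠ i, ρ i x • (f * g i) x = f x * ∑ᶠ i, ρ i x • g i x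
    rw [← ρ.sum_finsupport_smul_eq_finsum x (fun i => g i),
      ← ρ.sum_finsupport_smul_eq_finsum x (fun i => (f * g i : SmoothFun n M)), Finset.mul_sum]
    exact Finset.sum_congr rfl fun i _ => mul_left_comm (ρ i x) (f x) (g i x)

theorem partitionGlue_apply {ι : Type*} (ρ : SmoothPartitionOfUnity ι (𝓡 n) M univ)
    (g : ι → SmoothFun n M) (x : M) : partitionGlue ρ g x = ∑ᶠ i, ρ i x • g i x := rfl

variable [IsManifold (𝓡 n) ((⊤ : ℕ∞) : WithTop ℕ∞) M]

variable [T2Space M]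

/-- A frame of the algebra of smooth functions, from a partition of unity subordinate to open sets on
which given bump functions are `1`. -/
def localFrameOfPartition (b : ∀ c : M, SmoothBumpFunction (𝓡 n) c)
    (ρ : SmoothPartitionOfUnity M (𝓡 n) M univ) (hρ : ρ.IsSubordinate fun c => bumpOne (b c)) :
    LocalFrame (SmoothFun n M) where
  ι := M × Fin n
  coord i := chartCoord (b i.1) i.2
  field i := chartField (b i.1) (EuclideanSpace.single i.2 1)
  glue := partitionGlue ρ ∘ₗ
    LinearMap.pi fun c => ∑ j : Fin n, LinearMap.proj (c, j)
  expand X g := by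
    ext x
    rw [LinearMap.comp_apply, partitionGlue_apply]
    have h (c : M) : ρ c x • ((LinearMap.pi fun c => ∑ j : Fin n, LinearMap.proj (c, j) :
        (M × Fin n → SmoothFun n M) →ₗ[SmoothFun n M] M → SmoothFun n M) fun i =>
          X (chartCoord (b i.1) i.2) * chartField (b i.1) (EuclideanSpace.single i.2 1) g) c x =
        ρ c x • X g x := by
      -- Wherever `ρ c` is nonzero the bump of the chart at `c` is `1`, and the chart formula
      -- already gives all of `X g x`. The glued sum is thus a weighted mean of equal values.
      by_cases hc : ρ c x = 0
      · rw [hc, zero_smul, zero_smul]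
      · have hx : x ∈ bumpOne (b c) := hρ c (subset_tsupport _ hc)
        rw [derivation_apply_eq_sum X g hx, LinearMap.pi_apply, LinearMap.sum_apply,
          SmoothFun.sum_apply]
        rfl
    rw [finsum_congr h, ← ρ.sum_finsupport_smul_eq_finsum x (fun _ => X g), ← Finset.sum_smul,
      ρ.sum_finsupport x (mem_univ x), one_smul]
  -- Functions that meet only finitely many members of the partition. By local finiteness they
  -- include a bump function around each point, so they detect zero.
  cutoff := {ψ | ∃ s : Finset M, ∀ c ∉ s, ψ * ρ c = 0}
  eq_zero f hf := by
    ext x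
    obtain ⟨t, ht, hfin⟩ := ρ.locallyFinite x
    obtain ⟨β, hβ, -⟩ := (SmoothBumpFunction.nhds_basis_support (I := 𝓡 n) ht).mem_iff.1 ht
    have h := hf (bumpFun β) ⟨hfin.toFinset, fun c hc => by
      ext y
      change β y * ρ c y = 0
      by_contra h
      refine hc (hfin.mem_toFinset.2 ⟨y, ?_, hβ (subset_tsupport _ (left_ne_zero_of_mul h))⟩)
      exact right_ne_zero_of_mul h⟩
    have h1 : β x * f x = 0 := congrArg (fun k : SmoothFun n M => k x) h
    rwa [β.eq_one, one_mul] at h1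
  finite ψ := by
    rintro ⟨s, hs⟩
    refine ⟨s ×ˢ Finset.univ, fun i => ψ * ρ i.1, fun g => ?_⟩
    ext x
    rw [SmoothFun.sum_apply, Finset.sum_product]
    change ψ x * partitionGlue ρ _ x = ∑ c ∈ s, ∑ j, ψ x * ρ c x * g (c, j) x
    rw [partitionGlue_apply]
    by_cases hx : ψ x = 0
    · simp [hx]
    · rw [finsum_eq_sum_of_support_subset (s := s), Finset.mul_sum]
      · refine Finset.sum_congr rfl fun c _ => ?_
        rw [LinearMap.pi_apply, LinearMap.sum_apply, SmoothFun.sum_apply, smul_eq_mul, ← mul_assoc,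
          Finset.mul_sum]
        rfl
      · intro c hc
        by_contra hcs
        have h1 : ψ x * ρ c x = 0 := congrArg (fun k : SmoothFun n M => k x) (hs c hcs)
        have h2 : ρ c x = 0 := (mul_eq_zero.1 h1).resolve_left hx
        exact hc (by simp only [h2, zero_smul])

variable (n M) in
theorem exists_localFrame [SecondCountableTopology M] :
    Nonempty (LocalFrame.{u, u} (SmoothFun n M)) := by
  -- Together with second countability this gives σ-compactness, needed for the partition of unity.
  have : LocallyCompactSpace M := ChartedSpace.locallyCompactSpace (EuclideanSpace ℝ (Fin n)) M
  let b : ∀ c : M, SmoothBumpFunction (𝓡 n) c := fun c => Classical.arbitrary _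
  obtain ⟨ρ, hρ⟩ := SmoothPartitionOfUnity.exists_isSubordinate (𝓡 n) isClosed_univ
    (fun c => bumpOne (b c)) (fun c => isOpen_bumpOne (b c))
    fun c _ => mem_iUnion.2 ⟨c, mem_bumpOne (b c)⟩
  exact ⟨localFrameOfPartition b ρ hρ⟩

end Frame

end DeRham

end

theorem mainTheorem6 (n : ℕ) (M : Type*) [TopologicalSpace M] [T2Space M]
    [SecondCountableTopology M] [ChartedSpace (EuclideanSpace ℝ (Fin n)) M]
    [IsManifold (𝓡 n) ((⊤ : ℕ∞) : WithTop ℕ∞) M] :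
    DeRham.IsLieAlgebroid (DeRham.SmoothFun n M) (DeRham.deRhamD (DeRham.SmoothFun n M)) ∧
    DeRham.IsDeformationComplex (DeRham.SmoothFun n M)
      (DeRham.deRhamD (DeRham.SmoothFun n M)) ∧
    DeRham.IsAcyclicDeformationComplex (DeRham.SmoothFun n M)
      (DeRham.deRhamD (DeRham.SmoothFun n M)) ∧
    DeRham.IsRigid (DeRham.SmoothFun n M) (DeRham.deRhamD (DeRham.SmoothFun n M)) := by
  obtain ⟨B⟩ := DeRham.exists_localFrame n M
  exact ⟨DeRham.isLieAlgebroid_d, DeRham.isDeformationComplex_d,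
    DeRham.LocalFrame.isAcyclicDeformationComplex B,
    DeRham.isRigid_of_acyclic DeRham.isLieAlgebroid_d
      (DeRham.LocalFrame.isAcyclicDeformationComplex B)⟩
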